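/- Let $k$ be an algebraically closed field of characteristic zero and let $G$ be a finite group. Varieties are algebraic varieties over $k$, rational maps are rational maps over $k$, and points are $k$-points. A *rational action* of $G$ on an irreducible variety $X$ is a group embedding $\varrho\colon G\hookrightarrow \mathrm{Bir}(X)$ (so actions are faithful by definition); its *dimension* is $\dim X$. We say that $\varrho$ *has a fixed point* if there are an irreducible smooth complete variety $Y$ with a regular action of $G$ and a $G$-equivariant birational isomorphism $X\dashrightarrow Y$ such that $Y^G\neq\varnothing$. A *compression* of a rational action $\varrho_1$ of $G$ on $X_1$ into a rational action $\varrho_2$ of $G$ on $X_2$ is a $G$-equivariant dominant rational map $\varphi\colon X_1\dashrightarrow X_2$; one then also says that $\varrho_1$ is obtained from $\varrho_2$ by a base change, which is called *nontrivial* if $\varphi$ is not a birational isomorphism. Let $\mathrm{rdim}_k(G)$ be the minimum of the integers $m>0$ for which there is a group embedding $G\hookrightarrow \mathrm{GL}_m(k)$. **Theorem.** Let $\varrho$ be a rational action of $G$ on an irreducible variety of dimension $n\geqslant 1$. (i) If $\varrho$ has a fixed point, then $n\geqslant \mathrm{rdim}_k(G)$. (ii) If $n>\mathrm{rdim}_k(G)$,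 then there is a compression of $\varrho$ into a rational action of $G$ of dimension smaller than $n$. (iii) If $\lambda\colon G\hookrightarrow \mathrm{GL}_n(k)$ is a faithful $n$-dimensional linear representation, then either there is a compression of $\varrho$ into a rational action of $G$ of dimension smaller than $n$, or $\varrho$ is obtained by a nontrivial base change from the linear action of $G$ on $\mathbf A^n$ given by $\lambda$ ("or" is not exclusive). -/

import Mathlib

open CategoryTheory AlgebraicGeometry

universe u v

noncomputable section

/-- An irreducible algebraic variety over `k`: an integral, separated scheme of finite type
over `Spec k`.  It is used over algebraically closed `k`, where irreducible and geometrically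
irreducible mean the same. -/
structure Variety (k : Type u) [Field k] where
  scheme : Scheme.{u}
  str : scheme ⟶ Spec (.of k)
  isIntegral : IsIntegral scheme
  isSeparated : IsSeparated str
  locallyOfFiniteType : LocallyOfFiniteType str
  quasiCompact : QuasiCompact str

namespace Variety

variable {k : Type u} [Field k]

instance (X : Variety k) : X.scheme.Over (Spec (.of k)) := ⟨X.str⟩

attribute [instance] Variety.isIntegral Variety.isSeparated Variety.locallyOfFiniteType
  Variety.quasiCompact

/-- The dimension of a variety. -/
def dim (X : Variety k) : WithBot ℕ∞ := topologicalKrullDim X.scheme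

/-- A dominant rational map `X ⇢ Y` over `k`. -/
@[ext]
structure DominantRationalMap (X Y : Variety k) where
  map : X.scheme ⤏ Y.scheme
  isDominant : map.IsDominant
  isOver : map.IsOver (Spec (.of k))

attribute [instance] DominantRationalMap.isDominant DominantRationalMap.isOver

/-- A morphism of `k`-schemes with dense image, viewed as a dominant rational map. -/
def DominantRationalMap.ofHom {X Y : Variety k} (f : X.scheme ⟶ Y.scheme)
    (hd : IsDominant f) (hf : f ≫ Y.str = X.str) : DominantRationalMap X Y where
  map := f.toRationalMap
  isDominant := inferInstance
  isOver := by
    have : f.IsOver (Spec (.of k)) := ⟨hf⟩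
    infer_instance

/-- Irreducible varieties over `k` with the dominant rational maps over `k` as morphisms. Thus
`f ≫ g` is the composition `g ∘ f`, the isomorphisms `X ≅ Y` are the birational isomorphisms,
and `IsIso f` says that `f` is a birational isomorphism. -/
instance : Category (Variety k) where
  Hom X Y := DominantRationalMap X Y
  id X := DominantRationalMap.ofHom (𝟙 X.scheme) inferInstance (Category.id_comp _)
  comp f g := ⟨f.map.comp g.map, inferInstance, inferInstance⟩
  id_comp f := DominantRationalMap.ext (Scheme.RationalMap.id_comp f.map)
  comp_id f := DominantRationalMap.ext (Scheme.RationalMap.comp_id f.map)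
  assoc f g h := DominantRationalMap.ext (Scheme.RationalMap.comp_assoc f.map g.map h.map)

/-- The group `Bir(X)` of birational self-maps of `X` over `k`; the product `f * g` is `f ∘ g`. -/
abbrev Bir (X : Variety k) := Aut X

/-- The group `Aut(X)` of (biregular) automorphisms of `X` over `k`; the product `f * g` is
`f ∘ g`. -/
abbrev RegAut (X : Variety k) := Aut (Over.mk X.str)

lemma ofHom_comp_ofHom {X Y Z : Variety k} (f : X.scheme ⟶ Y.scheme)
    (hd : IsDominant f) (hf : f ≫ Y.str = X.str) (g : Y.scheme ⟶ Z.scheme)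
    (hd' : IsDominant g) (hg : g ≫ Z.str = Y.str)
    (hd'' : IsDominant (f ≫ g)) (h : (f ≫ g) ≫ Z.str = X.str) :
    (show X ⟶ Y from DominantRationalMap.ofHom f hd hf) ≫
      (show Y ⟶ Z from DominantRationalMap.ofHom g hd' hg) =
        DominantRationalMap.ofHom (f ≫ g) hd'' h := by
  refine DominantRationalMap.ext ?_
  change f.toRationalMap.comp g.toRationalMap = (f ≫ g).toRationalMap
  rw [Scheme.RationalMap.comp_toRationalMap]
  rfl

lemma isDominant_of_regAut {X : Variety k} (f : X.RegAut) : IsDominant f.hom.left := by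
  have : IsIso f.hom.left :=
    ⟨f.inv.left, congrArg CommaMorphism.left f.hom_inv_id,
      congrArg CommaMorphism.left f.inv_hom_id⟩
  infer_instance

/-- An automorphism of `X` as a birational self-map. -/
def regToBirHom {X : Variety k} (f : X.RegAut) : X ⟶ X :=
  DominantRationalMap.ofHom f.hom.left (isDominant_of_regAut f) (Over.w f.hom)

lemma regToBirHom_mul {X : Variety k} (f g : X.RegAut) :
    regToBirHom (f * g) = regToBirHom g ≫ regToBirHom f :=
  (ofHom_comp_ofHom _ _ _ _ _ _ (isDominant_of_regAut (f * g)) (Over.w (f * g).hom)).symm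

lemma regToBirHom_one {X : Variety k} : regToBirHom (1 : X.RegAut) = 𝟙 X := rfl

/-- The inclusion `Aut(X) ⊆ Bir(X)`, as a homomorphism of groups. -/
def regToBir (X : Variety k) : X.RegAut →* X.Bir where
  toFun f :=
    { hom := regToBirHom f
      inv := regToBirHom f⁻¹
      hom_inv_id := by rw [← regToBirHom_mul, inv_mul_cancel, regToBirHom_one]
      inv_hom_id := by rw [← regToBirHom_mul, mul_inv_cancel, regToBirHom_one] }
  map_one' := Iso.ext regToBirHom_one
  map_mul' f g := Iso.ext (regToBirHom_mul f g)

lemma toRationalMap_injective {X Y : Variety k} {f g : X.scheme ⟶ Y.scheme}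
    (hf : f ≫ Y.str = X.str) (hg : g ≫ Y.str = X.str)
    (h : f.toRationalMap = g.toRationalMap) : f = g := by
  rw [Scheme.Hom.toRationalMap, Scheme.PartialMap.toRationalMap_eq_iff] at h
  have i1 : f.IsOver (Spec (.of k)) := ⟨hf⟩
  have i2 : g.IsOver (Spec (.of k)) := ⟨hg⟩
  have i3 : IsSeparated (Y.scheme ↘ Spec (.of k)) := Y.isSeparated
  rw [Scheme.PartialMap.equiv_toPartialMap_iff_of_isSeparated (S := Spec (.of k))] at h
  have h2 : X.scheme.topIso.hom ≫ f = X.scheme.topIso.hom ≫ g := h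
  exact (cancel_epi _).1 h2

lemma regToBir_injective (X : Variety k) : Function.Injective X.regToBir := fun f g h =>
  Iso.ext (Over.OverMorphism.ext (toRationalMap_injective (Over.w f.hom) (Over.w g.hom)
    (congrArg (fun e : X.Bir => DominantRationalMap.map e.hom) h)))

/-- The affine space `𝐀ⁿ = Spec k[x₁, …, xₙ]` over `k`. -/
def affineSpace (k : Type u) [Field k] (n : ℕ) : Variety k where
  scheme := Spec (.of (MvPolynomial (Fin n) k))
  str := Spec.map (CommRingCat.ofHom MvPolynomial.C)
  isIntegral := inferInstance
  isSeparated := inferInstance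
  locallyOfFiniteType := by
    rw [HasRingHomProperty.Spec_iff (P := @LocallyOfFiniteType)]
    exact (RingHom.finiteType_algebraMap (A := k) (B := MvPolynomial (Fin n) k)).2 inferInstance
  quasiCompact := inferInstance

/-- The `k`-algebra endomorphism `xᵢ ↦ ∑ⱼ Mᵢⱼ xⱼ` of `k[x₁, …, xₙ]`. -/
def linearSubst {n : ℕ} (M : Matrix (Fin n) (Fin n) k) :
    MvPolynomial (Fin n) k →ₐ[k] MvPolynomial (Fin n) k :=
  MvPolynomial.aeval fun i => ∑ j, MvPolynomial.C (M i j) * MvPolynomial.X j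

lemma linearSubst_one {n : ℕ} :
    linearSubst (1 : Matrix (Fin n) (Fin n) k) = AlgHom.id k _ := by
  ext1 i
  simp [linearSubst, Matrix.one_apply]

lemma linearSubst_mul {n : ℕ} (M N : Matrix (Fin n) (Fin n) k) :
    linearSubst (M * N) = (linearSubst N).comp (linearSubst M) := by
  ext1 i
  simp only [linearSubst, AlgHom.comp_apply, MvPolynomial.aeval_X, map_sum, map_mul,
    MvPolynomial.algHom_C, Matrix.mul_apply, Finset.sum_mul, Finset.mul_sum,
    MvPolynomial.algebraMap_eq, mul_assoc]
  exact Finset.sum_comm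

lemma linearSubst_injective {n : ℕ} :
    Function.Injective (linearSubst : Matrix (Fin n) (Fin n) k → _) := by
  intro M N h
  ext i j
  have h1 := congrArg (MvPolynomial.coeff (Finsupp.single j 1)) (DFunLike.congr_fun h
    (MvPolynomial.X i))
  simpa [linearSubst, MvPolynomial.coeff_sum, MvPolynomial.coeff_C_mul, MvPolynomial.coeff_X,
    Finsupp.single_left_inj] using h1

/-- The linear morphism `a ↦ M a` of `𝐀ⁿ`, on coordinate functions `xᵢ ↦ ∑ⱼ Mᵢⱼ xⱼ`. -/
def linearHom {n : ℕ} (M : Matrix (Fin n) (Fin n) k) :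
    Over.mk (affineSpace k n).str ⟶ Over.mk (affineSpace k n).str :=
  Over.homMk (Spec.map (CommRingCat.ofHom (linearSubst M).toRingHom)) (by
    change Spec.map _ ≫ Spec.map _ = Spec.map _
    rw [← Spec.map_comp, ← CommRingCat.ofHom_comp]
    congr 2
    exact (linearSubst M).comp_algebraMap)

lemma linearHom_one {n : ℕ} : linearHom (1 : Matrix (Fin n) (Fin n) k) = 𝟙 _ := by
  refine Over.OverMorphism.ext ?_
  change Spec.map (CommRingCat.ofHom (linearSubst 1).toRingHom) = _
  rw [linearSubst_one]
  exact Spec.map_id _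

lemma linearHom_mul {n : ℕ} (M N : Matrix (Fin n) (Fin n) k) :
    linearHom (M * N) = linearHom N ≫ linearHom M := by
  refine Over.OverMorphism.ext ?_
  change Spec.map (CommRingCat.ofHom (linearSubst (M * N)).toRingHom) =
    Spec.map (CommRingCat.ofHom (linearSubst N).toRingHom) ≫
      Spec.map (CommRingCat.ofHom (linearSubst M).toRingHom)
  rw [← Spec.map_comp, ← CommRingCat.ofHom_comp, linearSubst_mul]
  rfl

lemma linearHom_injective {n : ℕ} :
    Function.Injective (linearHom : Matrix (Fin n) (Fin n) k → _) := by
  intro M N h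
  have h1 : Spec.map (CommRingCat.ofHom (linearSubst M).toRingHom) =
    Spec.map (CommRingCat.ofHom (linearSubst N).toRingHom) := congrArg CommaMorphism.left h
  have h2 := congrArg CommRingCat.Hom.hom (Spec.map_injective h1)
  exact linearSubst_injective (AlgHom.ext fun x => DFunLike.congr_fun h2 x)

/-- The inclusion `GLₙ(k) ⊆ Aut(𝐀ⁿ)`, as a homomorphism of groups. -/
def linearAut (k : Type u) [Field k] (n : ℕ) : GL (Fin n) k →* (affineSpace k n).RegAut where
  toFun M :=
    { hom := linearHom M.val
      inv := linearHom M⁻¹.val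
      hom_inv_id := by
        rw [← linearHom_mul, ← Units.val_mul, inv_mul_cancel, Units.val_one, linearHom_one]
      inv_hom_id := by
        rw [← linearHom_mul, ← Units.val_mul, mul_inv_cancel, Units.val_one, linearHom_one] }
  map_one' := Iso.ext linearHom_one
  map_mul' M N := Iso.ext (linearHom_mul M.val N.val)

lemma linearAut_injective (n : ℕ) : Function.Injective (linearAut k n) := fun _ _ h =>
  Units.ext (linearHom_injective (congrArg Iso.hom h))

end Variety

/-- A (faithful) rational action of `G` on `X`: a group embedding `G ↪ Bir(X)`. -/
structure RationalAction (G : Type v) [Group G] {k : Type u} [Field k] (X : Variety k) where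
  toHom : G →* X.Bir
  injective : Function.Injective toHom

namespace RationalAction

variable {G : Type v} [Group G] {k : Type u} [Field k] {X Y : Variety k}

/-- A `G`-equivariant dominant rational map `φ : X ⇢ Y`, that is, a compression of `ρ` into `σ`. -/
def IsCompression (ρ : RationalAction G X) (σ : RationalAction G Y) (φ : X ⟶ Y) : Prop :=
  ∀ g : G, (ρ.toHom g).hom ≫ φ = φ ≫ (σ.toHom g).hom

/-- `ρ` is obtained from `σ` by a nontrivial base change, that is, there is a compression of `ρ`
into `σ` that is not a birational isomorphism. -/
def IsNontrivialBaseChangeOf (ρ : RationalAction G X) (σ : RationalAction G Y) : Prop :=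
  ∃ φ : X ⟶ Y, ρ.IsCompression σ φ ∧ ¬ IsIso φ

/-- `ρ` is compressible into a (faithful) rational action of smaller dimension. -/
def CompressesToSmallerDim (ρ : RationalAction G X) : Prop :=
  ∃ (Y : Variety k) (σ : RationalAction G Y) (φ : X ⟶ Y), Y.dim < X.dim ∧ ρ.IsCompression σ φ

/-- The (faithful) action by automorphisms of `X`, viewed as a rational action. -/
def ofRegular (a : G →* X.RegAut) (ha : Function.Injective a) : RationalAction G X where
  toHom := X.regToBir.comp a
  injective := X.regToBir_injective.comp ha

/-- `ρ` has a fixed point: there are a smooth complete irreducible variety `Y` with a regular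
action of `G`, a `G`-equivariant birational isomorphism `X ⇢ Y`, and a `k`-point `y` of `Y`
fixed by `G`. -/
def HasFixedPoint (ρ : RationalAction G X) : Prop :=
  ∃ (Y : Variety k) (a : G →* Y.RegAut) (ha : Function.Injective a) (ψ : X ≅ Y)
    (y : Over.mk (𝟙 (Spec (.of k))) ⟶ Over.mk Y.str),
    Smooth Y.str ∧ IsProper Y.str ∧ ρ.IsCompression (ofRegular a ha) ψ.hom ∧
      ∀ g : G, y ≫ (a g).hom = y

/-- The linear action of `G` on `𝐀ⁿ` given by a faithful representation `r : G ↪ GLₙ(k)`. -/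
def linear {n : ℕ} (r : G →* GL (Fin n) k) (hr : Function.Injective r) :
    RationalAction G (Variety.affineSpace k n) :=
  ofRegular ((Variety.linearAut k n).comp r) ((Variety.linearAut_injective n).comp hr)

end RationalAction

/-- The minimum of the dimensions `m > 0` of faithful linear representations of `G` over `k`. -/
def rdim (k : Type u) [Field k] (G : Type v) [Group G] : ℕ :=
  sInf {m : ℕ | 0 < m ∧ ∃ r : G →* GL (Fin m) k, Function.Injective r}

end

/-! Everything is read off the function field K = k(X), on which G acts faithfully. Dominant
rational maps from X to an affine variety Spec A correspond to embeddings of k-algebras A → K.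

Compressions come from one construction: every linear representation of G has a copy inside K
(`exists_linearIndependent_equivariant`). The normal basis theorem puts the regular representation
over K^G into K, and K^G contains an element t transcendental over k whose powers keep the
coordinates independent. If the representation is faithful with basis b_1, …, b_m in K, then k[b_1,
…, b_m] is stable with faithful action, and its spectrum is the target of a compression
(`compressesToSmallerDim_of_linearIndependent`). Its dimension is at most m, which gives (ii).

For (iii), m = n. If the b_i are algebraically dependent, the dimension drops. Otherwise replace b_i
by f(b) b_i, where f is the product of the G-translates of a coordinate, an invariant form of degree
|G|. The equivariant map x ↦ f(x) x of affine space is constant on orbits of scaling by (|G|+1)-th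
roots of unity, so the resulting map from X to affine space is not birational
(`MvPolynomial.X_mul_aeval_ne`).

For (i), G acts on a stable affine neighbourhood of the fixed point, hence on the cotangent space
m/m². Smoothness bounds its dimension by n (`Algebra.Smooth.finrank_cotangent_le`). In
characteristic zero an automorphism of finite order that is trivial on m/m² is trivial modulo every
power of m, hence trivial by Krull's intersection theorem (`AlgEquiv.eq_one_of_sub_mem_sq`), so this
representation is faithful. -/

noncomputable section

/-! ### Rational maps at the generic point -/

namespace AlgebraicGeometry.Scheme

variable {X Y Z : Scheme.{u}}

lemma map_genericPoint_of_isDominant [IrreducibleSpace X] [IrreducibleSpace Y] (f : X ⟶ Y)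
    [IsDominant f] : f (genericPoint X) = genericPoint Y := by
  refine IsGenericPoint.eq (S := Set.univ) ?_ (genericPoint_spec Y)
  have h := (genericPoint_spec X).image f.continuous
  rwa [Set.image_univ, f.denseRange.closure_range] at h

lemma Opens.fromSpecStalkOfMem_closedPoint (U : X.Opens) (x : X) (hx : x ∈ U)
    (p : Spec (X.presheaf.stalk x)) (hp : p = IsLocalRing.closedPoint (X.presheaf.stalk x)) :
    U.fromSpecStalkOfMem x hx p = ⟨x, hx⟩ := by
  apply U.ι.isOpenEmbedding.injective
  rw [← Hom.comp_apply, Opens.fromSpecStalkOfMem_ι, hp]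
  exact fromSpecStalk_closedPoint

lemma PartialMap.fromFunctionField_closedPoint [IsIntegral X] [IrreducibleSpace Y]
    (f : X.PartialMap Y) [IsDominant f.hom] :
    f.fromFunctionField (IsLocalRing.closedPoint X.functionField) = genericPoint Y := by
  have hη : genericPoint X ∈ f.domain :=
    (genericPoint_specializes _).mem_open f.domain.2 f.dense_domain.nonempty.choose_spec
  have : Nonempty f.domain := ⟨⟨_, hη⟩⟩
  rw [← map_genericPoint_of_isDominant f.hom]
  refine (Hom.comp_apply (f.domain.fromSpecStalkOfMem _ hη) f.hom _).trans (congrArg f.hom ?_)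
  refine (Opens.fromSpecStalkOfMem_closedPoint _ _ _ _ rfl).trans ?_
  exact Subtype.ext (genericPoint_eq_of_isOpenImmersion f.domain.ι).symm

/-- Keeping `y` apart from the image point lets the stalk be taken at `genericPoint Y` itself, with
no transport along an equality. -/
lemma exists_SpecMap_comp_fromSpecStalk {R : CommRingCat.{u}} [IsLocalRing R] (f : Spec R ⟶ Y)
    {y : Y} (hy : f (IsLocalRing.closedPoint R) = y) :
    ∃ g : Y.presheaf.stalk y ⟶ R, Spec.map g ≫ Y.fromSpecStalk y = f := by
  subst hy
  exact ⟨_, Spec_stalkClosedPointTo_fromSpecStalk f⟩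

/-- Dominance sends generic point to generic point, so the restriction to the function field factors
through the stalk there. -/
lemma RationalMap.exists_functionField_hom [IsIntegral X] [IrreducibleSpace Y] (f : X ⤏ Y)
    [f.IsDominant] : ∃ g : Y.functionField ⟶ X.functionField,
      Spec.map g ≫ Y.fromSpecStalk _ = f.fromFunctionField := by
  rw [← f.toRationalMap_representative, RationalMap.fromFunctionField_toRationalMap]
  exact exists_SpecMap_comp_fromSpecStalk _ (PartialMap.fromFunctionField_closedPoint _)

lemma PartialMap.fromFunctionField_comp [IsIntegral X] [IsIntegral Y] (f : X.PartialMap Y)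
    [IsDominant f.hom] (g : Y.PartialMap Z) (φ : Y.functionField ⟶ X.functionField)
    (hφ : Spec.map φ ≫ Y.fromSpecStalk _ = f.fromFunctionField) :
    (f.comp g).fromFunctionField = Spec.map φ ≫ g.fromFunctionField := by
  have h1 : (genericPoint Y) ∈ g.domain :=
    (genericPoint_specializes _).mem_open g.domain.2 g.dense_domain.nonempty.choose_spec
  have h2 : (genericPoint X) ∈ f.domain :=
    (genericPoint_specializes _).mem_open f.domain.2 f.dense_domain.nonempty.choose_spec
  have h3 : (genericPoint X) ∈ f.domain.ι ''ᵁ f.hom ⁻¹ᵁ g.domain :=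
    (genericPoint_specializes _).mem_open (f.comp g).domain.2
      (f.comp g).dense_domain.nonempty.choose_spec
  change (f.domain.ι ''ᵁ f.hom ⁻¹ᵁ g.domain).fromSpecStalkOfMem _ h3 ≫
    (f.domain.ι.isoImage (f.hom ⁻¹ᵁ g.domain)).inv ≫
    f.hom ∣_ g.domain ≫ g.hom = Spec.map φ ≫ g.domain.fromSpecStalkOfMem _ h1 ≫ g.hom
  have h4 : (f.domain.ι ''ᵁ f.hom ⁻¹ᵁ g.domain).fromSpecStalkOfMem _ h3 ≫
      (f.domain.ι.isoImage (f.hom ⁻¹ᵁ g.domain)).inv ≫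
      (f.hom ⁻¹ᵁ g.domain).ι = f.domain.fromSpecStalkOfMem _ h2 := by
    rw [← cancel_mono f.domain.ι, Opens.fromSpecStalkOfMem_ι]
    simp only [Category.assoc, Hom.isoImage_inv_ι,
      Opens.fromSpecStalkOfMem_ι]
  have h5 : (f.domain.ι ''ᵁ f.hom ⁻¹ᵁ g.domain).fromSpecStalkOfMem _ h3 ≫
      (f.domain.ι.isoImage (f.hom ⁻¹ᵁ g.domain)).inv ≫
      f.hom ∣_ g.domain = Spec.map φ ≫ g.domain.fromSpecStalkOfMem _ h1 := by
    rw [← cancel_mono g.domain.ι]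
    simp only [Category.assoc, Opens.fromSpecStalkOfMem_ι, hφ, morphismRestrict_ι]
    rw [reassoc_of% h4]
    rfl
  rw [reassoc_of% h5]

lemma RationalMap.fromFunctionField_comp [IsIntegral X] [IsIntegral Y] (f : X ⤏ Y)
    [f.IsDominant] (g : Y ⤏ Z) (φ : Y.functionField ⟶ X.functionField)
    (hφ : Spec.map φ ≫ Y.fromSpecStalk _ = f.fromFunctionField) :
    (f.comp g).fromFunctionField = Spec.map φ ≫ g.fromFunctionField := by
  rw [← g.toRationalMap_representative]
  exact PartialMap.fromFunctionField_comp f.representative g.representative φ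
    (by rw [hφ, ← RationalMap.fromFunctionField_toRationalMap, f.toRationalMap_representative])

lemma RationalMap.fromFunctionField_toRationalMap_hom [IsIntegral X] (f : X ⟶ Y) :
    f.toRationalMap.fromFunctionField = X.fromSpecStalk _ ≫ f :=
  PartialMap.fromSpecStalkOfMem_toPartialMap f _

end AlgebraicGeometry.Scheme

/-! ### Pullback of rational functions -/

namespace Variety

variable {k : Type u} [Field k] {X Y Z : Variety k}

/-- The map of function fields induced by a dominant rational map. -/
def pull (φ : X ⟶ Y) : Y.scheme.functionField ⟶ X.scheme.functionField :=
  (Scheme.RationalMap.exists_functionField_hom (DominantRationalMap.map φ)).choose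

lemma pull_spec (φ : X ⟶ Y) : Spec.map (pull φ) ≫ Y.scheme.fromSpecStalk _ =
    (DominantRationalMap.map φ).fromFunctionField :=
  (Scheme.RationalMap.exists_functionField_hom (DominantRationalMap.map φ)).choose_spec

lemma fromFunctionField_comp (φ : X ⟶ Y) (ψ : Y ⟶ Z) :
    (DominantRationalMap.map (φ ≫ ψ)).fromFunctionField =
      Spec.map (pull φ) ≫ (DominantRationalMap.map ψ).fromFunctionField :=
  Scheme.RationalMap.fromFunctionField_comp _ _ _ (pull_spec φ)

lemma hom_ext_of_fromFunctionField {φ ψ : X ⟶ Y}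
    (h : (DominantRationalMap.map φ).fromFunctionField =
      (DominantRationalMap.map ψ).fromFunctionField) : φ = ψ :=
  DominantRationalMap.ext (Scheme.RationalMap.eq_of_fromFunctionField_eq _ _ h)

lemma pull_injective {φ ψ : X ⟶ Y} (h : pull φ = pull ψ) : φ = ψ :=
  hom_ext_of_fromFunctionField (by rw [← pull_spec, h, pull_spec])

lemma pull_comp (φ : X ⟶ Y) (ψ : Y ⟶ Z) : pull (φ ≫ ψ) = pull ψ ≫ pull φ := by
  apply Spec.map_injective
  rw [← cancel_mono (Z.scheme.fromSpecStalk _), pull_spec, fromFunctionField_comp, Spec.map_comp,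
    Category.assoc, pull_spec]

lemma pull_id : pull (𝟙 X) = 𝟙 _ := by
  apply Spec.map_injective
  rw [← cancel_mono (X.scheme.fromSpecStalk _), pull_spec, Spec.map_id, Category.id_comp]
  exact (Scheme.RationalMap.fromFunctionField_toRationalMap_hom (𝟙 X.scheme)).trans
    (Category.comp_id _)

/-- The inclusion of the base field into the function field. -/
def baseHom (X : Variety k) : CommRingCat.of k ⟶ X.scheme.functionField :=
  Spec.preimage (X.scheme.fromSpecStalk _ ≫ X.str)

lemma SpecMap_baseHom (X : Variety k) :
    Spec.map X.baseHom = X.scheme.fromSpecStalk _ ≫ X.str :=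
  Spec.map_preimage _

instance (X : Variety k) : Algebra k X.scheme.functionField := X.baseHom.hom.toAlgebra

lemma fromFunctionField_comp_str (φ : X ⟶ Y) :
    (DominantRationalMap.map φ).fromFunctionField ≫ Y.str = Spec.map X.baseHom := by
  have h := Scheme.RationalMap.isOver_iff.mp (DominantRationalMap.isOver φ)
  rw [SpecMap_baseHom]
  have h1 := congrArg Scheme.RationalMap.fromFunctionField h
  rw [Scheme.RationalMap.fromFunctionField_toRationalMap_hom] at h1
  rw [← (DominantRationalMap.map φ).toRationalMap_representative] at h1 ⊢
  exact (Scheme.PartialMap.fromSpecStalkOfMem_compHom _ _ _ _).symm.trans h1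

lemma baseHom_pull (φ : X ⟶ Y) : Y.baseHom ≫ pull φ = X.baseHom := by
  apply Spec.map_injective
  rw [Spec.map_comp, SpecMap_baseHom, ← Category.assoc, pull_spec, fromFunctionField_comp_str]

/-- The map of function fields induced by a dominant rational map, as a `k`-algebra map. -/
def pullAlg (φ : X ⟶ Y) : Y.scheme.functionField →ₐ[k] X.scheme.functionField where
  __ := (pull φ).hom
  commutes' a := congrArg (fun f => f.hom a) (baseHom_pull φ)

lemma pullAlg_comp (φ : X ⟶ Y) (ψ : Y ⟶ Z) :
    pullAlg (φ ≫ ψ) = (pullAlg φ).comp (pullAlg ψ) :=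
  AlgHom.ext fun x => congrArg (fun f => f.hom x) (pull_comp φ ψ)

lemma pullAlg_id : pullAlg (𝟙 X) = AlgHom.id k _ :=
  AlgHom.ext fun x => congrArg (fun f => f.hom x) (pull_id (X := X))

lemma pullAlg_injective {φ ψ : X ⟶ Y} (h : pullAlg φ = pullAlg ψ) : φ = ψ :=
  pull_injective (CommRingCat.hom_ext (RingHom.ext fun x => DFunLike.congr_fun h x))

/-- A morphism to a variety from the spectrum of the function field extends to a dominant
rational map as soon as it hits the generic point. -/
lemma exists_hom_of_fromFunctionField (f : Spec X.scheme.functionField ⟶ Y.scheme)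
    (hf : f ≫ Y.str = Spec.map X.baseHom) [IsDominant f] :
    ∃ φ : X ⟶ Y, (DominantRationalMap.map φ).fromFunctionField = f := by
  -- As `Y` is of finite type, a `k`-morphism from the generic point spreads out to an open subset.
  let e := Scheme.RationalMap.equivFunctionField X.str Y.str
  let F := e ⟨f, by rw [hf, SpecMap_baseHom]⟩
  have hF : F.1.fromFunctionField = f := congrArg Subtype.val (e.symm_apply_apply _)
  refine ⟨⟨F.1, ?_, Scheme.RationalMap.isOver_iff.mpr F.2⟩, hF⟩
  rw [← F.1.toRationalMap_representative, Scheme.PartialMap.isDominant_toRationalMap_iff]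
  rw [← F.1.toRationalMap_representative, Scheme.RationalMap.fromFunctionField_toRationalMap] at hF
  have : IsDominant (F.1.representative.fromFunctionField) := by rw [hF]; infer_instance
  exact IsDominant.of_comp (H := this)

end Variety

/-! ### Copies of a representation inside a field with group action -/

section EquivariantEmbedding

variable {k : Type*} [Field k] {K : Type*} [Field K] [Algebra k K] {G : Type*} [Group G] [Finite G]

/-- `K` is Galois over the fixed field `F` with group `G`, and `w` generates a normal basis. Since
`K` is algebraic over `F`, the field `F` is not algebraic over `k`, which provides `t`. -/
lemma exists_linearIndependent_orbit_and_transcendental_invariant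
    (hK : ¬ Algebra.IsAlgebraic k K) (τ : G →* (K ≃ₐ[k] K)) (hτ : Function.Injective τ) :
    ∃ w t : K, (∀ g, τ g t = t) ∧ Transcendental k t ∧
      ∀ c : G → K, (∀ g h, τ g (c h) = c h) → ∑ᶠ g, c g * τ g w = 0 → ∀ g, c g = 0 := by
  let : MulSemiringAction G K := MulSemiringAction.compHom K τ
  have hs (g : G) (x : K) : g • x = τ g x := rfl
  have : SMulCommClass G k K := ⟨fun g a x => by simp [hs]⟩
  have : FaithfulSMul G K := ⟨fun {g h} H => hτ (AlgEquiv.ext fun x => H x)⟩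
  let F : IntermediateField k K := FixedPoints.intermediateField G
  have : IsGaloisGroup G F K := ⟨inferInstance, ⟨fun g x y => by
    rw [Algebra.smul_def, Algebra.smul_def, smul_mul']; exact congrArg (· * g • y) (x.2 g)⟩,
    ⟨fun x hx => ⟨⟨x, hx⟩, rfl⟩⟩⟩
  have : FiniteDimensional F K := IsGaloisGroup.finiteDimensional G F K
  have : IsGalois F K := IsGaloisGroup.isGalois G F K
  obtain ⟨w, hw⟩ := exists_linearIndependent_algEquiv_apply F K
  have hF : ¬ Algebra.IsAlgebraic k F := fun h => hK (Algebra.IsAlgebraic.trans k F K)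
  obtain ⟨t, ht⟩ : ∃ t : F, Transcendental k t := by
    by_contra! h
    exact hF ⟨fun t => by simpa [Transcendental] using h t⟩
  refine ⟨w, t, fun g => t.2 g, ?_, fun c hc h => ?_⟩
  · exact (transcendental_algebraMap_iff (FaithfulSMul.algebraMap_injective F K)).mpr ht
  · have hw' := hw.comp _ (IsGaloisGroup.mulEquivAlgEquiv G F K).injective
    let c' : G → F := fun g => ⟨c g, fun h => hc h g⟩
    cases nonempty_fintype G
    rw [finsum_eq_sum_of_fintype] at h
    have := Fintype.linearIndependent_iff.mp hw' c' h
    exact fun g => congrArg Subtype.val (this g)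

/-- With v = (1, t, …, t^(n-1)), the vector b = ∑_g (r(g) v) τ_g(w) works: reindexing the sum gives
equivariance, and a linear relation among the b_i, read at the coefficient of `w`, is a relation
among powers of `t`. -/
lemma exists_linearIndependent_equivariant (hK : ¬ Algebra.IsAlgebraic k K)
    (τ : G →* (K ≃ₐ[k] K)) (hτ : Function.Injective τ) {n : ℕ} (r : G →* GL (Fin n) k) :
    ∃ b : Fin n → K, LinearIndependent k b ∧
      ∀ g i, τ g⁻¹ (b i) = ∑ j, (r g).val i j • b j := by
  obtain ⟨w, t, ht, htr, hw⟩ :=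
    exists_linearIndependent_orbit_and_transcendental_invariant hK τ hτ
  cases nonempty_fintype G
  let c : G → Fin n → K := fun g i => ∑ l, (r g).val i l • t ^ (l : ℕ)
  have hc (g h : G) (i : Fin n) : τ g (c h i) = c h i := by simp [c, ht]
  have hcm (g h : G) (i : Fin n) : c (g * h) i = ∑ j, (r g).val i j • c h j := by
    simp only [c, map_mul, Units.val_mul, Matrix.mul_apply, Finset.sum_smul, Finset.smul_sum,
      mul_smul]
    exact Finset.sum_comm
  refine ⟨fun i => ∑ g, c g i * τ g w, ?_, fun g i => ?_⟩
  · rw [Fintype.linearIndependent_iff]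
    intro v hv
    have h1 := hw (fun g => ∑ i, v i • c g i) (fun g h => by simp [hc]) (by
      rw [finsum_eq_sum_of_fintype, ← hv]
      simp only [Finset.smul_sum, Finset.sum_mul, smul_mul_assoc]
      exact Finset.sum_comm) 1
    have h2 : LinearIndependent k fun l : Fin n => t ^ (l : ℕ) :=
      by
        have := ((Polynomial.basisMonomials k).linearIndependent.map'
          (Polynomial.aeval t).toLinearMap (LinearMap.ker_eq_bot.mpr (transcendental_iff_injective.mp htr))).comp _
          (Fin.val_injective (n := n))
        simpa [Function.comp_def] using this
    refine Fintype.linearIndependent_iff.mp h2 v ?_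
    simpa [c, Matrix.one_apply] using h1
  · simp only [map_sum, map_mul, hc]
    rw [← Equiv.sum_comp (Equiv.mulLeft g)]
    simp only [Equiv.coe_mulLeft, hcm, Finset.smul_sum, Finset.sum_mul, smul_mul_assoc,
      ← AlgEquiv.mul_apply, ← mul_assoc, ← map_mul, inv_mul_cancel, one_mul]
    exact Finset.sum_comm

end EquivariantEmbedding

/-! ### Krull dimension and transcendence degree -/

section Dimension

/-- Lying over lifts the bottom of a chain of primes, and going up lifts the rest. -/
lemma ringKrullDim_le_of_isIntegral_of_injective {R S : Type*} [CommRing R] [CommRing S]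
    [Algebra R S] [Algebra.IsIntegral R S] [FaithfulSMul R S] :
    ringKrullDim R ≤ ringKrullDim S := by
  refine iSup_le fun l => ?_
  obtain ⟨P, hP, hlo⟩ := Ideal.exists_ideal_over_prime_of_isIntegral l.head.asIdeal (⊥ : Ideal S)
    (by simp [← RingHom.ker_eq_comap_bot,
      (RingHom.injective_iff_ker_eq_bot _).mp (FaithfulSMul.algebraMap_injective R S)])
  have : P.LiesOver l.head.asIdeal := ⟨hlo.2.symm⟩
  have : P.IsPrime := hlo.1
  obtain ⟨L, hL, -⟩ := Ideal.exists_ltSeries_of_hasGoingUp (S := S) l P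
  rw [← hL]
  exact Order.LTSeries.length_le_krullDim L

/-- By Noether normalization `A` is integral over a polynomial ring in `s` variables, and `s` is its
transcendence degree. -/
lemma trdeg_le_of_ringKrullDim_le (k : Type*) [Field k] (A : Type*) [CommRing A] [IsDomain A]
    [Algebra k A] [Algebra.FiniteType k A] {n : ℕ} (h : ringKrullDim A ≤ n) :
    Algebra.trdeg k A ≤ n := by
  obtain ⟨s, g, hg, hi⟩ := exists_integral_inj_algHom_of_fg k A
  algebraize [g.toRingHom]
  have hfs : FaithfulSMul (MvPolynomial (Fin s) k) A :=
    (faithfulSMul_iff_algebraMap_injective _ _).mpr hg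
  have hint : Algebra.IsIntegral (MvPolynomial (Fin s) k) A := ⟨hi⟩
  have h1 := (ringKrullDim_le_of_isIntegral_of_injective (R := MvPolynomial (Fin s) k)
    (S := A)).trans h
  rw [MvPolynomial.ringKrullDim_of_isNoetherianRing, ringKrullDim_eq_zero_of_field, zero_add,
    Nat.card_eq_fintype_card, Fintype.card_fin] at h1
  have h2 : s ≤ n := by exact_mod_cast h1
  have h3 := lift_trdeg_add_eq k (MvPolynomial (Fin s) k) A
  rw [trdeg_eq_zero (R := MvPolynomial (Fin s) k), MvPolynomial.trdeg_of_isDomain] at h3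
  have h4 : Algebra.trdeg k A = s := by simpa using h3.symm
  rw [h4]
  exact_mod_cast h2

end Dimension

/-! ### Sections over affine opens, and the dimension of a variety -/

namespace Variety

variable {k : Type u} [Field k] (X : Variety k)

/-- The inclusion of the base field into the ring of sections over an open subset. -/
def sectionsBaseHom (U : X.scheme.Opens) : CommRingCat.of k ⟶ Γ(X.scheme, U) :=
  (Scheme.ΓSpecIso (.of k)).inv ≫ X.str.appLE ⊤ U le_top

variable {X} {U : X.scheme.Opens}

lemma SpecMap_sectionsBaseHom (hU : IsAffineOpen U) :
    Spec.map (X.sectionsBaseHom U) = hU.fromSpec ≫ X.str := by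
  rw [← IsAffineOpen.SpecMap_appLE_fromSpec X.str (isAffineOpen_top _) hU le_top,
    IsAffineOpen.fromSpec_top, sectionsBaseHom, Spec.map_comp, Scheme.isoSpec_Spec_inv]

lemma SpecMap_germToFunctionField [Nonempty U] (hU : IsAffineOpen U) :
    Spec.map (X.scheme.germToFunctionField U) ≫ hU.fromSpec = X.scheme.fromSpecStalk _ :=
  hU.fromSpecStalk_eq_fromSpecStalk _

lemma sectionsBaseHom_germToFunctionField [Nonempty U] (hU : IsAffineOpen U) :
    X.sectionsBaseHom U ≫ X.scheme.germToFunctionField U = X.baseHom := by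
  apply Spec.map_injective
  rw [Spec.map_comp, SpecMap_sectionsBaseHom hU, ← Category.assoc, SpecMap_germToFunctionField,
    SpecMap_baseHom]

/-- The ring of sections over an open subset as an algebra over the base field. -/
@[reducible] def sectionsAlgebra (U : X.scheme.Opens) : Algebra k Γ(X.scheme, U) :=
  (X.sectionsBaseHom U).hom.toAlgebra

attribute [local instance] sectionsAlgebra

lemma isScalarTower_sections [Nonempty U] (hU : IsAffineOpen U) :
    IsScalarTower k Γ(X.scheme, U) X.scheme.functionField :=
  .of_algebraMap_eq' (congrArg CommRingCat.Hom.hom (sectionsBaseHom_germToFunctionField hU)).symm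

lemma finiteType_sections (hU : IsAffineOpen U) : Algebra.FiniteType k Γ(X.scheme, U) := by
  have h := (X.str.finiteType_appLE (isAffineOpen_top _) hU le_top)
  have h1 : (X.sectionsBaseHom U).hom.FiniteType :=
    h.comp (.of_surjective _ (Scheme.ΓSpecIso (.of k)).symm.commRingCatIsoToRingEquiv.surjective)
  exact RingHom.finiteType_algebraMap.mp h1

lemma exists_isAffineOpen_mem (x : X.scheme) :
    ∃ U : X.scheme.Opens, IsAffineOpen U ∧ x ∈ U := by
  obtain ⟨_, ⟨U, hU, rfl⟩, hx, -⟩ := X.scheme.isBasis_affineOpens.exists_subset_of_mem_open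
    (Set.mem_univ x) isOpen_univ
  exact ⟨U, hU, hx⟩

lemma ringKrullDim_sections_le (hU : IsAffineOpen U) : ringKrullDim Γ(X.scheme, U) ≤ X.dim := by
  rw [← PrimeSpectrum.topologicalKrullDim_eq_ringKrullDim]
  exact (hU.fromSpec.isOpenEmbedding.isInducing).topologicalKrullDim_le

lemma trdeg_functionField_le {n : ℕ} (h : X.dim ≤ n) :
    Algebra.trdeg k X.scheme.functionField ≤ n := by
  obtain ⟨U, hU, hx⟩ := exists_isAffineOpen_mem (genericPoint X.scheme)
  have : Nonempty U := ⟨⟨_, hx⟩⟩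
  have := isScalarTower_sections hU
  have := finiteType_sections hU
  have := functionField_isFractionRing_of_isAffineOpen X.scheme U hU
  have h1 := trdeg_le_of_ringKrullDim_le k Γ(X.scheme, U) ((ringKrullDim_sections_le hU).trans h)
  have : FaithfulSMul Γ(X.scheme, U) X.scheme.functionField :=
    (faithfulSMul_iff_algebraMap_injective _ _).mpr (IsFractionRing.injective _ _)
  have : FaithfulSMul k Γ(X.scheme, U) :=
    (faithfulSMul_iff_algebraMap_injective _ _).mpr (algebraMap k Γ(X.scheme, U)).injective
  have : Algebra.IsAlgebraic Γ(X.scheme, U) X.scheme.functionField :=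
    IsLocalization.isAlgebraic _ (nonZeroDivisors Γ(X.scheme, U))
  have h2 := trdeg_add_eq k Γ(X.scheme, U) (A := X.scheme.functionField)
  rw [trdeg_eq_zero (R := Γ(X.scheme, U)), add_zero] at h2
  rwa [← h2]

/-- If the function field were algebraic over `k`, sections over each nonempty affine open would
form a field. Such an open is a single point and contains the generic point, so `X` would be a
point. -/
lemma not_isAlgebraic_functionField (h : ¬ X.dim ≤ 0) :
    ¬ Algebra.IsAlgebraic k X.scheme.functionField := by
  intro halg
  refine h ?_
  have hsub : Subsingleton X.scheme := by
    refine ⟨fun x y => ?_⟩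
    suffices ∀ x : X.scheme, x = genericPoint X.scheme from (this x).trans (this y).symm
    intro x
    obtain ⟨U, hU, hx⟩ := exists_isAffineOpen_mem x
    have : Nonempty U := ⟨⟨_, hx⟩⟩
    have := isScalarTower_sections hU
    have : FaithfulSMul Γ(X.scheme, U) X.scheme.functionField :=
      (faithfulSMul_iff_algebraMap_injective _ _).mpr (X.scheme.germToFunctionField_injective U)
    have : Algebra.IsAlgebraic k Γ(X.scheme, U) := Algebra.IsAlgebraic.of_injective
      (IsScalarTower.toAlgHom k Γ(X.scheme, U) X.scheme.functionField)
      (X.scheme.germToFunctionField_injective U)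
    have hf : IsField Γ(X.scheme, U) :=
      isField_of_isIntegral_of_isField' (Field.toIsField k)
    have hs : Subsingleton (PrimeSpectrum Γ(X.scheme, U)) := by
      let := hf.toField
      infer_instance
    have hr := hU.range_fromSpec
    obtain ⟨a, ha⟩ : x ∈ Set.range hU.fromSpec := hr ▸ hx
    obtain ⟨b, hb⟩ : genericPoint X.scheme ∈ Set.range hU.fromSpec := hr ▸
      (genericPoint_specializes x).mem_open U.2 hx
    rw [← ha, ← hb]
    exact congrArg _ (Subsingleton.elim (α := PrimeSpectrum Γ(X.scheme, U)) a b)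
  exact topologicalKrullDim_zero_of_discreteTopology _

end Variety

/-- The restriction of an action by algebra automorphisms to a stable subalgebra. -/
def Subalgebra.restrictAction {R B G : Type*} [CommSemiring R] [Semiring B] [Algebra R B] [Group G]
    (S : Subalgebra R B) (τ : G →* (B ≃ₐ[R] B)) (h : ∀ g, ∀ x ∈ S, τ g x ∈ S) :
    G →* (S ≃ₐ[R] S) where
  toFun g := AlgEquiv.ofAlgHom
    (AlgHom.codRestrict ((τ g : B →ₐ[R] B).comp S.val) S fun x => h g x x.2)
    (AlgHom.codRestrict ((τ g⁻¹ : B →ₐ[R] B).comp S.val) S fun x => h g⁻¹ x x.2)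
    (AlgHom.ext fun x => Subtype.ext <| by
      change (τ g * τ g⁻¹) x = x
      rw [← map_mul, mul_inv_cancel, map_one, AlgEquiv.one_apply])
    (AlgHom.ext fun x => Subtype.ext <| by
      change (τ g⁻¹ * τ g) x = x
      rw [← map_mul, inv_mul_cancel, map_one, AlgEquiv.one_apply])
  map_one' := AlgEquiv.ext fun x => Subtype.ext <| by
    change τ 1 x = x
    rw [map_one, AlgEquiv.one_apply]
  map_mul' g h := AlgEquiv.ext fun x => Subtype.ext <| by
    change τ (g * h) x = τ g (τ h x)
    rw [map_mul, AlgEquiv.mul_apply]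

lemma AlgebraicGeometry.Scheme.exists_fromSpecStalk_eq_of_isDomain (R : CommRingCat.{u})
    [IsDomain R] : ∃ ι : R ⟶ (Spec R).functionField,
      Spec.map ι = (Spec R).fromSpecStalk (genericPoint (Spec R)) ∧
      ∀ y : (Spec R).functionField, ∃ p q : R, q ≠ 0 ∧ y * ι.hom q = ι.hom p := by
  refine ⟨CommRingCat.ofHom (algebraMap R (Spec R).functionField),
    (Spec.fromSpecStalk_eq' R _).symm, fun y => ?_⟩
  obtain ⟨p, q, hq, rfl⟩ := IsFractionRing.div_surjective (A := R) y
  have hq0 : q ≠ 0 := nonZeroDivisors.ne_zero hq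
  have hq1 : algebraMap R (Spec R).functionField q ≠ 0 := by simpa using hq0
  exact ⟨p, q, hq0, div_mul_cancel₀ _ hq1⟩

/-! ### Affine varieties and maps to them -/

namespace Variety

variable {k : Type u} [Field k] {X : Variety k}

section Affine

variable (k) (A : Type u) [CommRing A] [IsDomain A] [Algebra k A] [Algebra.FiniteType k A]

/-- The affine variety with a given coordinate ring. -/
def affineVariety : Variety k where
  scheme := Spec (.of A)
  str := Spec.map (CommRingCat.ofHom (algebraMap k A))
  isIntegral := inferInstance
  isSeparated := inferInstance
  locallyOfFiniteType := by
    rw [HasRingHomProperty.Spec_iff (P := @LocallyOfFiniteType)]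
    exact (RingHom.finiteType_algebraMap (A := k) (B := A)).2 inferInstance
  quasiCompact := inferInstance

lemma dim_affineVariety : (affineVariety k A).dim = ringKrullDim A :=
  PrimeSpectrum.topologicalKrullDim_eq_ringKrullDim (R := A)

variable {k A}

/-- The endomorphism of an affine variety given by an endomorphism of its coordinate ring. -/
def affineHom (f : A →ₐ[k] A) :
    Over.mk (affineVariety k A).str ⟶ Over.mk (affineVariety k A).str :=
  Over.homMk (Spec.map (CommRingCat.ofHom f.toRingHom)) (by
    change Spec.map _ ≫ Spec.map _ = Spec.map _
    rw [← Spec.map_comp, ← CommRingCat.ofHom_comp]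
    congr 2
    exact f.comp_algebraMap)

lemma affineHom_comp (f g : A →ₐ[k] A) : affineHom (f.comp g) = affineHom f ≫ affineHom g := by
  refine Over.OverMorphism.ext ?_
  change Spec.map (CommRingCat.ofHom (f.comp g).toRingHom) =
    Spec.map (CommRingCat.ofHom f.toRingHom) ≫ Spec.map (CommRingCat.ofHom g.toRingHom)
  rw [← Spec.map_comp, ← CommRingCat.ofHom_comp]
  rfl

lemma affineHom_id : affineHom (AlgHom.id k A) = 𝟙 _ :=
  Over.OverMorphism.ext (Spec.map_id _)

lemma affineHom_injective : Function.Injective (affineHom : (A →ₐ[k] A) → _) := by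
  intro f g h
  have h1 : Spec.map (CommRingCat.ofHom f.toRingHom) = Spec.map (CommRingCat.ofHom g.toRingHom) :=
    congrArg CommaMorphism.left h
  have h2 := congrArg CommRingCat.Hom.hom (Spec.map_injective h1)
  exact AlgHom.ext fun x => DFunLike.congr_fun h2 x

variable {G : Type v} [Group G]

/-- The regular action on an affine variety given by an action on its coordinate ring. -/
def affineAction (τ : G →* (A ≃ₐ[k] A)) : G →* (affineVariety k A).RegAut where
  toFun g :=
    -- `Spec` is contravariant; the inverse restores a left action.
    { hom := affineHom (τ g⁻¹)
      inv := affineHom (τ g)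
      hom_inv_id := by
        rw [← affineHom_comp, ← affineHom_id]
        refine congrArg affineHom (AlgHom.ext fun x => ?_)
        change (τ g⁻¹ * τ g) x = x
        rw [← map_mul, inv_mul_cancel, map_one, AlgEquiv.one_apply]
      inv_hom_id := by
        rw [← affineHom_comp, ← affineHom_id]
        refine congrArg affineHom (AlgHom.ext fun x => ?_)
        change (τ g * τ g⁻¹) x = x
        rw [← map_mul, mul_inv_cancel, map_one, AlgEquiv.one_apply] }
  map_one' := by
    ext1
    change affineHom _ = 𝟙 _
    rw [← affineHom_id, inv_one, map_one]
    rfl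
  map_mul' g h := by
    ext1
    change affineHom _ = affineHom _ ≫ affineHom _
    rw [← affineHom_comp, mul_inv_rev, map_mul]
    rfl

lemma affineAction_injective {τ : G →* (A ≃ₐ[k] A)} (hτ : Function.Injective τ) :
    Function.Injective (affineAction τ) := by
  intro g h H
  have h1 := affineHom_injective (congrArg Iso.hom H)
  exact inv_injective (hτ (AlgEquiv.ext fun x => DFunLike.congr_fun h1 x))

/-- Injectivity of `θ` is what makes `Spec θ` dominant. -/
lemma exists_hom_affineVariety (θ : A →ₐ[k] X.scheme.functionField)
    (hθ : Function.Injective θ) : ∃ φ : X ⟶ affineVariety k A,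
      (DominantRationalMap.map φ).fromFunctionField = Spec.map (CommRingCat.ofHom θ.toRingHom) := by
  let f : Spec X.scheme.functionField ⟶ (affineVariety k A).scheme :=
    Spec.map (CommRingCat.ofHom θ.toRingHom)
  have hd : IsDominant f := by
    refine ⟨?_⟩
    refine (PrimeSpectrum.denseRange_comap_iff_ker_le_nilRadical (f := θ.toRingHom)).mpr ?_
    rw [(RingHom.injective_iff_ker_eq_bot θ.toRingHom).mp hθ]
    exact bot_le
  refine exists_hom_of_fromFunctionField f ?_
  exact (Spec.map_comp _ _).symm.trans (congrArg Spec.map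
    (CommRingCat.hom_ext (RingHom.ext fun x => θ.commutes x)))

/-- Every rational function on the source is a quotient of functions pulled back along a
birational isomorphism onto an affine variety. -/
lemma exists_mul_eq_of_isIso (θ : A →ₐ[k] X.scheme.functionField) (φ : X ⟶ affineVariety k A)
    (hφ : (DominantRationalMap.map φ).fromFunctionField =
      Spec.map (CommRingCat.ofHom θ.toRingHom)) [IsIso φ] (x : X.scheme.functionField) :
    ∃ p q : A, q ≠ 0 ∧ x * θ q = θ p := by
  obtain ⟨ι, hι, hfrac⟩ := Scheme.exists_fromSpecStalk_eq_of_isDomain (.of A)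
  have hθ (a : A) : pull φ (ι.hom a) = θ a := by
    have h1 := pull_spec φ
    rw [hφ] at h1
    have h2 : Spec.map (pull φ) ≫ Spec.map ι = Spec.map (CommRingCat.ofHom θ.toRingHom) :=
      (congrArg (Spec.map (pull φ) ≫ ·) hι).trans h1
    have h3 : ι ≫ pull φ = CommRingCat.ofHom θ.toRingHom :=
      Spec.map_injective ((Spec.map_comp _ _).trans h2)
    exact congrArg (fun f => f.hom a) h3
  have hx : pull φ (pull (inv φ) x) = x := by
    have := pull_comp φ (inv φ)
    rw [IsIso.hom_inv_id, pull_id] at this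
    exact (congrArg (fun f => f.hom x) this).symm
  obtain ⟨p, q, hq, h⟩ := hfrac (pull (inv φ) x)
  refine ⟨p, q, hq, ?_⟩
  refine (congrArg₂ (· * ·) hx.symm (hθ q).symm).trans (Eq.trans ?_ (hθ p))
  exact (map_mul (pull φ).hom _ _).symm.trans (congrArg (pull φ).hom h)

end Affine

end Variety

/-! ### Actions on function fields and compressions to affine models -/

namespace RationalAction

open Variety

variable {G : Type v} [Group G] {k : Type u} [Field k] {X : Variety k}

/-- The action on the function field induced by a rational action. -/
def fieldAction (ρ : RationalAction G X) :
    G →* (X.scheme.functionField ≃ₐ[k] X.scheme.functionField) where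
  toFun g := AlgEquiv.ofAlgHom (pullAlg (ρ.toHom g⁻¹).hom) (pullAlg (ρ.toHom g).hom)
    (by rw [← pullAlg_comp, ← pullAlg_id, map_inv]; exact congrArg _ (ρ.toHom g).inv_hom_id)
    (by rw [← pullAlg_comp, ← pullAlg_id, map_inv]; exact congrArg _ (ρ.toHom g).hom_inv_id)
  map_one' := by
    refine AlgEquiv.ext fun x => ?_
    change pullAlg (ρ.toHom 1⁻¹).hom x = x
    rw [inv_one, map_one]
    exact DFunLike.congr_fun pullAlg_id x
  map_mul' g h := by
    refine AlgEquiv.ext fun x => ?_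
    change pullAlg (ρ.toHom (g * h)⁻¹).hom x =
      pullAlg (ρ.toHom g⁻¹).hom (pullAlg (ρ.toHom h⁻¹).hom x)
    rw [mul_inv_rev, map_mul]
    exact DFunLike.congr_fun (pullAlg_comp (ρ.toHom g⁻¹).hom (ρ.toHom h⁻¹).hom) x

/-- Equivariance is stated at `g⁻¹` below because that is pullback along the action of `g`. -/
lemma fieldAction_inv_apply (ρ : RationalAction G X) (g : G) (x : X.scheme.functionField) :
    ρ.fieldAction g⁻¹ x = pullAlg (ρ.toHom g).hom x := by
  change pullAlg (ρ.toHom g⁻¹⁻¹).hom x = _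
  rw [inv_inv]

lemma fieldAction_injective (ρ : RationalAction G X) : Function.Injective ρ.fieldAction := by
  intro g h H
  refine inv_injective (ρ.injective (Iso.ext (pullAlg_injective (AlgHom.ext fun x => ?_))))
  exact DFunLike.congr_fun H x

variable {A : Type u} [CommRing A] [IsDomain A] [Algebra k A] [Algebra.FiniteType k A]

/-- Rational maps are determined at the generic point, where both composites are `Spec` of ring maps
from `A` to the function field. -/
lemma isCompression_ofRegular (ρ : RationalAction G X) (a : G →* (affineVariety k A).RegAut)
    (ha : Function.Injective a) (σ : G → A →ₐ[k] A)
    (hσ : ∀ g, (a g).hom.left = Spec.map (CommRingCat.ofHom (σ g).toRingHom))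
    (θ : A →ₐ[k] X.scheme.functionField) (φ : X ⟶ affineVariety k A)
    (hφ : (DominantRationalMap.map φ).fromFunctionField =
      Spec.map (CommRingCat.ofHom θ.toRingHom))
    (h : ∀ g x, ρ.fieldAction g⁻¹ (θ x) = θ (σ g x)) : ρ.IsCompression (ofRegular a ha) φ := by
  intro g
  apply hom_ext_of_fromFunctionField
  rw [Variety.fromFunctionField_comp, Variety.fromFunctionField_comp, hφ]
  have h1 : Spec.map (pull φ) ≫
      (DominantRationalMap.map ((ofRegular a ha).toHom g).hom).fromFunctionField =
      Spec.map (CommRingCat.ofHom θ.toRingHom) ≫ (a g).hom.left :=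
    (congrArg (Spec.map (pull φ) ≫ ·) (Scheme.RationalMap.fromFunctionField_toRationalMap_hom
      (X := (affineVariety k A).scheme) (a g).hom.left)).trans
      ((Category.assoc _ _ _).symm.trans (congrArg (· ≫ (a g).hom.left) ((pull_spec φ).trans hφ)))
  rw [h1, hσ]
  change Spec.map _ ≫ Spec.map _ = Spec.map _ ≫ Spec.map _
  rw [← Spec.map_comp, ← Spec.map_comp]
  congr 1
  ext x
  exact (fieldAction_inv_apply ρ g (θ x)).symm.trans (h g x)

/-- The target is the spectrum of the stable subalgebra generated by the `b i`. -/
lemma compressesToSmallerDim_of_linearIndependent (ρ : RationalAction G X) {m : ℕ}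
    (r : G →* GL (Fin m) k) (hr : Function.Injective r) (b : Fin m → X.scheme.functionField)
    (hb : LinearIndependent k b)
    (h : ∀ g i, ρ.fieldAction g⁻¹ (b i) = ∑ j, (r g).val i j • b j)
    (hdim : ringKrullDim (MvPolynomial.aeval b : MvPolynomial (Fin m) k →ₐ[k] _).range < X.dim) :
    ρ.CompressesToSmallerDim := by
  let S := (MvPolynomial.aeval b : MvPolynomial (Fin m) k →ₐ[k] _).range
  have hbS (i) : b i ∈ S := ⟨MvPolynomial.X i, by simp⟩
  have hfix : ∀ g, ∀ x ∈ S, ρ.fieldAction g x ∈ S := by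
    rintro g _ ⟨p, rfl⟩
    have : (ρ.fieldAction g : _ →ₐ[k] _).comp (MvPolynomial.aeval b) =
        MvPolynomial.aeval fun i => ρ.fieldAction g (b i) := by ext i; simp
    have h2 := DFunLike.congr_fun this p
    change ρ.fieldAction g _ = _ at h2
    have h3 : ∀ i, ρ.fieldAction g (b i) ∈ S := fun i => by
      rw [← inv_inv g, h]
      exact sum_mem fun j _ => S.smul_mem (hbS j) _
    have h4 : MvPolynomial.aeval (fun i => ρ.fieldAction g (b i)) =
        S.val.comp (MvPolynomial.aeval fun i => (⟨_, h3 i⟩ : S)) := by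
      ext i
      simp
    have h5 := DFunLike.congr_fun h4 p
    exact (h2.trans h5) ▸ Subtype.property _
  have : Algebra.FiniteType k S :=
    .of_surjective (MvPolynomial.aeval b).rangeRestrict (AlgHom.rangeRestrict_surjective _)
  let τ := S.restrictAction ρ.fieldAction hfix
  -- If `g` fixes every `b i`, linear independence forces the matrix of `g⁻¹` to be the identity,
  -- and `r` is faithful.
  have hτ : Function.Injective τ := by
    rw [injective_iff_map_eq_one]
    intro g hg
    suffices r g⁻¹ = 1 by simpa using hr (this.trans (map_one r).symm)
    ext i j
    have h1 : ρ.fieldAction g (b i) = b i :=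
      congrArg Subtype.val (DFunLike.congr_fun hg (⟨b i, hbS i⟩ : S))
    have h2 := h g⁻¹ i
    rw [inv_inv, h1] at h2
    have h3 : ∑ j, (1 : Matrix (Fin m) (Fin m) k) i j • b j = ∑ j, (r g⁻¹).val i j • b j := by
      rw [← h2]
      simp [Matrix.one_apply]
    exact (Fintype.linearIndependent_iffₛ.mp hb _ _ h3 j).symm
  obtain ⟨φ, hφ⟩ := exists_hom_affineVariety (X := X) S.val Subtype.val_injective
  refine ⟨affineVariety k S, ofRegular (affineAction τ) (affineAction_injective hτ), φ, ?_, ?_⟩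
  · rwa [dim_affineVariety]
  · exact isCompression_ofRegular ρ _ _ (fun g => (τ g⁻¹ : S →ₐ[k] S)) (fun g => rfl) S.val φ hφ
      fun g x => rfl

end RationalAction

/-! ### Faithful representations and polynomial images -/

lemma Matrix.exists_monoidHom_GL_injective (R : Type*) [CommRing R] [Nontrivial R] (G : Type*)
    [Group G] [Finite G] : ∃ r : G →* GL (Fin (Nat.card G)) R, Function.Injective r := by
  classical
  let e : G ≃ Fin (Nat.card G) := Finite.equivFin G
  -- The regular representation; the inverse is needed because `permMatrix` reverses products.
  let f : G →* Matrix (Fin (Nat.card G)) (Fin (Nat.card G)) R :=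
    { toFun g := (e.permCongr (MulAction.toPerm g⁻¹)).permMatrix R
      map_one' := by
        ext i j
        simp [Equiv.Perm.permMatrix, PEquiv.toMatrix_apply, Matrix.one_apply, Equiv.toPEquiv_apply]
      map_mul' g h := by
        rw [← Matrix.permMatrix_mul]
        congr 1
        ext i
        simp [mul_assoc, Equiv.permCongr_apply] }
  refine ⟨f.toHomUnits, fun g h H => ?_⟩
  have h1 : f g = f h := congrArg Units.val H
  have h2 := congrFun (congrFun h1 (e 1)) (e g⁻¹)
  by_contra hne
  have : ¬ h⁻¹ = g⁻¹ := fun h3 => hne (inv_injective h3).symm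
  simp [f, Equiv.Perm.permMatrix, PEquiv.toMatrix_apply, Equiv.toPEquiv_apply,
    Equiv.permCongr_apply, this] at h2

lemma exists_faithful_rdim (k : Type u) [Field k] (G : Type v) [Group G] [Finite G] :
    ∃ r : G →* GL (Fin (rdim k G)) k, Function.Injective r :=
  (Nat.sInf_mem (s := {m : ℕ | 0 < m ∧ ∃ r : G →* GL (Fin m) k, Function.Injective r})
    ⟨_, Nat.card_pos, Matrix.exists_monoidHom_GL_injective k G⟩).2

lemma MvPolynomial.ringKrullDim_range_le {k A : Type*} [Field k] [CommRing A] [Algebra k A] {m : ℕ}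
    (f : MvPolynomial (Fin m) k →ₐ[k] A) : ringKrullDim f.range ≤ m := by
  refine (ringKrullDim_le_of_surjective _ f.rangeRestrict_surjective).trans ?_
  simp [MvPolynomial.ringKrullDim_of_isNoetherianRing]

/-- A nonzero kernel element is a non-zero-divisor, so the quotient loses at least one dimension. -/
lemma MvPolynomial.ringKrullDim_range_lt {k A : Type*} [Field k] [CommRing A] [IsDomain A]
    [Algebra k A] {m : ℕ} (f : MvPolynomial (Fin m) k →ₐ[k] A) (hf : ¬ Function.Injective f) :
    ringKrullDim f.range < m := by
  rw [injective_iff_map_eq_zero] at hf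
  push Not at hf
  obtain ⟨p, hp, hp0⟩ := hf
  have h := ringKrullDim_succ_le_of_surjective (f := f.rangeRestrict.toRingHom) (r := p)
    f.rangeRestrict_surjective (mem_nonZeroDivisors_of_ne_zero hp0) (Subtype.ext hp)
  have h2 : ringKrullDim (MvPolynomial (Fin m) k) = m := by
    simp [MvPolynomial.ringKrullDim_of_isNoetherianRing]
  rw [h2] at h
  have h3 : 0 ≤ ringKrullDim f.range := ringKrullDim_nonneg_of_nontrivial
  -- In `WithBot ℕ∞`, passing from `d + 1 ≤ m` to `d < m` needs `d` to be finite.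
  revert h h3
  generalize ringKrullDim f.range = d
  intro h h3
  induction d with
  | bot => simp at h3
  | coe d =>
    induction d with
    | top => exact absurd h (by exact_mod_cast (ENat.natCast_lt_top m).not_ge)
    | coe d => norm_cast at h ⊢

/-- If `f` is an eigenvector of the scaling `xᵢ ↦ ζ xᵢ`, then `xᵢ` is not a quotient of
polynomials in the `f xⱼ`. -/
lemma MvPolynomial.X_mul_aeval_ne {k σ : Type*} [Field k] {f : MvPolynomial σ k} {d : ℕ} (ζ : k)
    (hf : aeval (R := k) (fun j => C ζ * X j) f = C ζ ^ d * f) (hζ : ζ ^ (d + 1) = 1)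
    (hζ1 : ζ ≠ 1) (i : σ)
    (p q : MvPolynomial σ k) (hq : aeval (R := k) (fun j => f * X j) q ≠ 0) :
    X i * aeval (R := k) (fun j => f * X j) q ≠ aeval (R := k) (fun j => f * X j) p := by
  intro h
  let s : MvPolynomial σ k →ₐ[k] MvPolynomial σ k := aeval fun j => C ζ * X j
  -- Each `f * X j` is fixed by the scaling, as it is multiplied by ζ^d ζ = 1. A quotient of
  -- polynomials in these would be fixed too, whereas `X i` is multiplied by `ζ`.
  have hh (p : MvPolynomial σ k) : s (aeval (fun j => f * X j) p) = aeval (fun j => f * X j) p := by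
    have : s.comp (aeval fun j => f * X j) = aeval fun j => f * X j := by
      ext1 j
      have h1 : C ζ ^ d * f * (C ζ * X j) = C (ζ ^ (d + 1)) * (f * X j) := by
        rw [map_pow]; ring
      rw [AlgHom.comp_apply, aeval_X, map_mul, hf, aeval_X, h1, hζ, map_one, one_mul]
    exact DFunLike.congr_fun this p
  have h1 := congrArg s h
  rw [map_mul, hh, hh, ← h, aeval_X] at h1
  have h2 := mul_right_cancel₀ hq h1
  have h3 := mul_right_cancel₀ (X_ne_zero i) (h2.trans (one_mul _).symm)
  exact hζ1 (C_injective σ k (h3.trans (map_one C).symm))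

lemma exists_pow_eq_one_and_ne_one (k : Type*) [Field k] [IsAlgClosed k] [CharZero k] {d : ℕ}
    (hd : d ≠ 0) : ∃ ζ : k, ζ ^ (d + 1) = 1 ∧ ζ ≠ 1 := by
  have : NeZero ((d + 1 : ℕ) : k) := ⟨by exact_mod_cast d.succ_ne_zero⟩
  obtain ⟨ζ, hζ⟩ := HasEnoughRootsOfUnity.exists_primitiveRoot k (d + 1)
  exact ⟨ζ, hζ.pow_eq_one, hζ.ne_one (by omega)⟩

namespace Variety

open MvPolynomial

variable {k : Type u} [Field k] {n : ℕ}

lemma linearSubst_X (M : Matrix (Fin n) (Fin n) k) (i : Fin n) :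
    linearSubst M (X i) = ∑ j, C (M i j) * X j := by
  simp [linearSubst]

/-- A nonzero invariant polynomial that scalings multiply by scalars. -/
lemma exists_invariant {G : Type v} [Group G] [Finite G] (r : G →* GL (Fin n) k) (i : Fin n) :
    ∃ f : MvPolynomial (Fin n) k, f ≠ 0 ∧ (∀ g, linearSubst (r g).val f = f) ∧
      ∀ ζ : k, aeval (fun j => C ζ * X j) f = C ζ ^ Nat.card G * f := by
  have := Fintype.ofFinite G
  -- The product of the translates of one coordinate: a product of |G| linear forms.
  refine ⟨∏ g, linearSubst (r g).val (X i), ?_, fun h => ?_, fun ζ => ?_⟩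
  · refine Finset.prod_ne_zero_iff.mpr fun g _ h => X_ne_zero (R := k) i ?_
    have h1 := congrArg (linearSubst (r g)⁻¹.val) h
    rwa [← AlgHom.comp_apply, ← linearSubst_mul, ← Units.val_mul, mul_inv_cancel, Units.val_one,
      linearSubst_one, map_zero] at h1
  · rw [map_prod]
    refine (Finset.prod_congr rfl fun g _ => ?_).trans
      (Equiv.prod_comp (Equiv.mulRight h) fun g => linearSubst (r g).val (X i))
    rw [← AlgHom.comp_apply, ← linearSubst_mul, Equiv.coe_mulRight, map_mul, Units.val_mul]
  · rw [map_prod, Nat.card_eq_fintype_card, ← Finset.card_univ, ← Finset.prod_const,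
      ← Finset.prod_mul_distrib]
    refine Finset.prod_congr rfl fun g _ => ?_
    rw [linearSubst_X, map_sum, Finset.mul_sum]
    refine Finset.sum_congr rfl fun j _ => ?_
    rw [map_mul, algHom_C, aeval_X, algebraMap_eq]
    ring

end Variety

/-! ### Compression and nontrivial base change -/

namespace RationalAction

open Variety MvPolynomial

variable {G : Type v} [Group G] {k : Type u} [Field k] {X : Variety k}

lemma exists_equivariant [CharZero k] [Finite G] (ρ : RationalAction G X) {n : ℕ} (hn : 1 ≤ n)
    (hX : X.dim = n) {m : ℕ} (r : G →* GL (Fin m) k) :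
    ∃ b : Fin m → X.scheme.functionField, LinearIndependent k b ∧
      ∀ g i, ρ.fieldAction g⁻¹ (b i) = ∑ j, (r g).val i j • b j := by
  refine exists_linearIndependent_equivariant (not_isAlgebraic_functionField ?_) ρ.fieldAction
    ρ.fieldAction_injective r
  rw [hX]
  norm_cast
  omega

theorem compressesToSmallerDim_of_rdim_lt [CharZero k] [Finite G] (ρ : RationalAction G X) {n : ℕ}
    (hX : X.dim = n) (h : rdim k G < n) : ρ.CompressesToSmallerDim := by
  obtain ⟨r, hr⟩ := exists_faithful_rdim k G
  obtain ⟨b, hb, hrb⟩ := ρ.exists_equivariant (by omega) hX r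
  refine ρ.compressesToSmallerDim_of_linearIndependent r hr b hb hrb ?_
  rw [hX]
  exact (ringKrullDim_range_le _).trans_lt (by exact_mod_cast h)

theorem compressesToSmallerDim_or_isNontrivialBaseChangeOf_linear [IsAlgClosed k] [CharZero k]
    [Finite G] (ρ : RationalAction G X) {n : ℕ} (hn : 1 ≤ n) (hX : X.dim = n)
    (r : G →* GL (Fin n) k) (hr : Function.Injective r) :
    ρ.CompressesToSmallerDim ∨ ρ.IsNontrivialBaseChangeOf (linear r hr) := by
  obtain ⟨b, hb, hrb⟩ := ρ.exists_equivariant hn hX r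
  by_cases hinj : Function.Injective (aeval b : MvPolynomial (Fin n) k →ₐ[k] _)
  swap
  · refine .inl (ρ.compressesToSmallerDim_of_linearIndependent r hr b hb hrb ?_)
    rw [hX]
    exact ringKrullDim_range_lt _ hinj
  have equivariant (b : Fin n → X.scheme.functionField)
      (h : ∀ g i, ρ.fieldAction g⁻¹ (b i) = ∑ j, (r g).val i j • b j) (g : G)
      (p : MvPolynomial (Fin n) k) :
      ρ.fieldAction g⁻¹ (aeval b p) = aeval b (linearSubst (r g).val p) := by
    have : (ρ.fieldAction g⁻¹ : _ →ₐ[k] _).comp (aeval b) =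
        (aeval b).comp (linearSubst (r g).val) := by
      ext1 i
      refine (congrArg _ (aeval_X b i)).trans ((h g i).trans ?_)
      simp [linearSubst_X, Algebra.smul_def]
    exact DFunLike.congr_fun this p
  obtain ⟨f, hf0, hf, hfs⟩ := exists_invariant r ⟨0, hn⟩
  -- Multiplying by the invariant `f(b)` preserves equivariance and destroys birationality.
  let b' : Fin n → X.scheme.functionField := fun i => aeval b (f * MvPolynomial.X i)
  have hb' : LinearIndependent k b' := by
    rw [Fintype.linearIndependent_iff] at hb ⊢
    intro c hc
    refine hb c ?_
    have h0 : aeval b f ≠ 0 := (map_ne_zero_iff _ hinj).mpr hf0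
    refine (mul_eq_zero.mp ?_).resolve_left h0
    rw [Finset.mul_sum, ← hc]
    refine Finset.sum_congr rfl fun i _ => ?_
    simp [b']
  have hrb' (g i) : ρ.fieldAction g⁻¹ (b' i) = ∑ j, (r g).val i j • b' j := by
    simp only [b']
    rw [equivariant b hrb, map_mul, hf, linearSubst_X, Finset.mul_sum, map_sum]
    refine Finset.sum_congr rfl fun j _ => ?_
    rw [← map_smul, MvPolynomial.smul_eq_C_mul]
    congr 1
    ring
  by_cases hinj' : Function.Injective (aeval b' : MvPolynomial (Fin n) k →ₐ[k] _)
  swap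
  · refine .inl (ρ.compressesToSmallerDim_of_linearIndependent r hr b' hb' hrb' ?_)
    rw [hX]
    exact ringKrullDim_range_lt _ hinj'
  right
  obtain ⟨φ, hφ⟩ := exists_hom_affineVariety (X := X) (aeval b') hinj'
  refine ⟨φ, isCompression_ofRegular ρ _ _ (fun g => linearSubst (r g).val) (fun g => rfl) _ φ hφ
    (equivariant b' hrb'), fun hiso => ?_⟩
  -- `affineSpace k n` is definitionally this affine variety.
  have : IsIso (Y := affineVariety k (MvPolynomial (Fin n) k)) φ := hiso
  obtain ⟨p, q, hq, h⟩ := exists_mul_eq_of_isIso _ φ hφ (b ⟨0, hn⟩)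
  have hcomp (p : MvPolynomial (Fin n) k) :
      aeval b' p = aeval b (aeval (fun j => f * MvPolynomial.X j) p) := by
    have : aeval (R := k) b' = (aeval b).comp (aeval (fun j => f * MvPolynomial.X j)) := by
      ext1 i
      simp [b']
    exact DFunLike.congr_fun this p
  -- The exponent is |G| + 1, the degree of `f * X j`.
  obtain ⟨ζ, hζ, hζ1⟩ := exists_pow_eq_one_and_ne_one k (d := Nat.card G) Nat.card_pos.ne'
  refine X_mul_aeval_ne ζ (hfs ζ) hζ hζ1 ⟨0, hn⟩ p q (fun h0 => hq (hinj' ?_)) (hinj ?_)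
  · rw [hcomp, h0, map_zero, map_zero]
  · rw [map_mul, aeval_X, ← hcomp, ← hcomp, h]

end RationalAction

/-! ### The cotangent representation at a fixed point -/

section

open TensorProduct

/-- The differentials of a transcendence basis span: `K` is separable algebraic over the field `F`
they generate, so Ω[K⁄F] = 0 and Ω[K⁄k] comes from Ω[F⁄k]. -/
lemma KaehlerDifferential.finrank_le_trdeg (k K : Type u) [Field k] [Field K] [Algebra k K]
    [CharZero k] {n : ℕ} (h : Algebra.trdeg k K ≤ n) : Module.finrank K Ω[K⁄k] ≤ n := by
  obtain ⟨s, hs⟩ := exists_isTranscendenceBasis k K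
  have hcard := hs.cardinalMk_eq_trdeg
  rw [← hcard] at h
  have hfin : Finite s := Cardinal.lt_aleph0_iff_finite.mp (h.trans_lt Cardinal.natCast_lt_aleph0)
  have := Fintype.ofFinite s
  let F := IntermediateField.adjoin k s
  have halg : Algebra.IsAlgebraic F K := by
    have := hs.isAlgebraic_field
    rwa [Subtype.range_coe] at this
  have hsep : Algebra.IsSeparable F K := inferInstance
  have hunr : Algebra.FormallyUnramified F K := .of_isSeparable F K
  let V : Submodule K Ω[K⁄k] := Submodule.span K (Set.range fun x : s => D k K x)
  have hF (x : K) (hx : x ∈ F) : D k K x ∈ V := by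
    induction hx using IntermediateField.adjoin_induction with
    | mem x hx => exact Submodule.subset_span ⟨⟨x, hx⟩, rfl⟩
    | algebraMap x => simp
    | add x y _ _ hx hy => rw [map_add]; exact add_mem hx hy
    | inv x _ hx => rw [Derivation.leibniz_inv]; exact V.smul_mem _ hx
    | mul x y _ _ hx hy =>
      rw [Derivation.leibniz]
      exact add_mem (V.smul_mem _ hy) (V.smul_mem _ hx)
  have hV : V = ⊤ := by
    rw [eq_top_iff, ← LinearMap.ker_eq_top.mpr (Subsingleton.elim (map k F K K) 0)]
    rw [LinearMap.exact_iff.mp (exact_mapBaseChange_map k F K)]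
    rintro _ ⟨x, rfl⟩
    induction x using TensorProduct.induction_on with
    | zero => simp
    | add x y hx hy => rw [map_add]; exact add_mem hx hy
    | tmul a w =>
      rw [mapBaseChange_tmul]
      refine V.smul_mem a ?_
      have : w ∈ Submodule.span F (Set.range (D k F)) := by
        rw [span_range_derivation]; trivial
      induction this using Submodule.span_induction with
      | mem w hw =>
        obtain ⟨x, rfl⟩ := hw
        rw [map_D]
        exact hF _ x.2
      | zero => simp
      | add x y _ _ hx hy => rw [map_add]; exact add_mem hx hy
      | smul c x _ hx =>
        rw [map_smul, ← algebraMap_smul K]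
        exact V.smul_mem _ hx
  rw [← finrank_top, ← hV]
  refine (finrank_range_le_card _).trans ?_
  rw [← Nat.card_eq_fintype_card]
  exact_mod_cast (Nat.cast_card (α := s)).trans_le h

/-- By smoothness the cotangent space embeds in the fibre of Ω[B⁄k] at the point. This module has
constant rank because Spec B is connected, and its generic fibre is Ω[K⁄k]. -/
lemma Algebra.Smooth.finrank_cotangent_le {k B : Type u} [Field k] [CharZero k] [CommRing B]
    [IsDomain B] [Algebra k B] [Algebra.Smooth k B] (K : Type u) [Field K] [Algebra B K]
    [IsFractionRing B K] [Algebra k K] [IsScalarTower k B K] (ε : B →ₐ[k] k) {n : ℕ}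
    (h : Algebra.trdeg k K ≤ n) :
    Module.Finite k (RingHom.ker ε).Cotangent ∧
      Module.finrank k (RingHom.ker ε).Cotangent ≤ n := by
  let : Algebra B k := ε.toRingHom.toAlgebra
  have : IsScalarTower k B k := .of_algebraMap_eq fun x => (ε.commutes x).symm
  have hsurj : Function.Surjective (algebraMap B k) := fun x => ⟨algebraMap k B x, ε.commutes x⟩
  have hinj : Function.Injective (KaehlerDifferential.kerCotangentToTensor k B k) :=
    (Algebra.FormallySmooth.kerCotangentToTensor_injective_iff hsurj).mpr inferInstance
  have hrank : Module.finrank k (k ⊗[B] Ω[B⁄k]) = Module.finrank K (K ⊗[B] Ω[B⁄k]) := by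
    have h1 := Module.rankAtStalk_baseChange (R := B) (M := Ω[B⁄k]) (S := k) ⊥
    have h2 := Module.rankAtStalk_baseChange (R := B) (M := Ω[B⁄k]) (S := K) ⊥
    rw [Module.rankAtStalk_eq_finrank_of_free] at h1 h2
    have h3 := (Module.isLocallyConstant_rankAtStalk (R := B)
      (M := Ω[B⁄k])).apply_eq_of_preconnectedSpace
      ((⊥ : PrimeSpectrum k).comap (algebraMap B k)) ((⊥ : PrimeSpectrum K).comap (algebraMap B K))
    exact h1.trans (h3.trans h2.symm)
  have : Algebra.FormallyEtale B K := .of_isLocalization (nonZeroDivisors B)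
  have hle : Module.finrank k (k ⊗[B] Ω[B⁄k]) ≤ n := by
    rw [hrank, (KaehlerDifferential.tensorKaehlerEquivOfFormallyEtale k B K).finrank_eq]
    exact KaehlerDifferential.finrank_le_trdeg k K h
  let f := (KaehlerDifferential.kerCotangentToTensor k B k).restrictScalars k
  exact ⟨.of_injective f hinj, (LinearMap.finrank_le_finrank_of_injective (f := f) hinj).trans hle⟩

/-- The operator s - 1 raises the m-adic filtration by one. An induction using the finite order of
`s` and characteristic zero puts its image in every power of `m`, and Krull's intersection theorem
concludes. -/
lemma AlgEquiv.eq_one_of_sub_mem_sq {k B : Type*} [Field k] [CharZero k] [CommRing B]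
    [IsDomain B] [IsNoetherianRing B] [Algebra k B] (ε : B →ₐ[k] k) (s : B ≃ₐ[k] B)
    (hs : IsOfFinOrder s) (hε : ∀ b, ε (s b) = ε b)
    (h : ∀ b, ε b = 0 → s b - b ∈ RingHom.ker ε ^ 2) : s = 1 := by
  set m := RingHom.ker ε
  have hm : m ≠ ⊤ := RingHom.ker_ne_top ε
  have hδ (b) : s b - b ∈ m ^ 2 := by
    have := h (b - algebraMap k B (ε b)) (by simp)
    simpa using this
  have hstab (i) (b) (hb : b ∈ m ^ i) : s b ∈ m ^ i := by
    have : m ^ i ≤ (m ^ i).comap s := by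
      refine le_trans ?_ (Ideal.le_comap_pow s i)
      refine Ideal.pow_right_mono (fun b hb => ?_) i
      exact (hε b).trans hb
    exact this hb
  have hδpow (i) : ∀ b ∈ m ^ i, s b - b ∈ m ^ (i + 1) := by
    induction i with
    | zero => exact fun b _ => Ideal.pow_le_pow_right one_le_two (hδ b)
    | succ i ih =>
      intro b hb
      rw [pow_succ] at hb
      induction hb using Submodule.mul_induction_on' with
      | mem_mul_mem x hx y hy =>
        have h1 : s (x * y) - x * y = s x * (s y - y) + (s x - x) * y := by rw [map_mul]; ring
        rw [h1]
        refine add_mem ?_ ?_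
        · rw [show i + 1 + 1 = i + 2 by rfl, pow_add]
          exact Ideal.mul_mem_mul (hstab i x hx) (hδ y)
        · rw [pow_succ]
          exact Ideal.mul_mem_mul (ih x hx) hy
      | add x _ y _ hx hy =>
        rw [map_add, add_sub_add_comm]
        exact add_mem hx hy
  have key (i) : ∀ b, s b - b ∈ m ^ i := by
    induction i with
    | zero => simp
    | succ i ih =>
      intro b
      -- Modulo m^(i+1) the powers of `s` move `b` additively; at j = orderOf s this leaves a
      -- multiple of s b - b by an invertible integer.
      have h1 (j : ℕ) : (s ^ j) b - b - j * (s b - b) ∈ m ^ (i + 1) := by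
        induction j with
        | zero => simp
        | succ j hj =>
          have h2 : (s ^ (j + 1)) b - b - ((j + 1 : ℕ) : B) * (s b - b) =
              s ((s ^ j) b - b - j * (s b - b)) + j * (s (s b - b) - (s b - b)) := by
            rw [pow_succ', AlgEquiv.mul_apply]
            simp only [map_sub, map_mul, map_natCast, Nat.cast_add, Nat.cast_one]
            ring
          rw [h2]
          exact add_mem (hstab _ _ hj) (Ideal.mul_mem_left _ _ (hδpow i _ (ih b)))
      have h2 := h1 (orderOf s)
      rw [pow_orderOf_eq_one, AlgEquiv.one_apply, sub_self, zero_sub, neg_mem_iff] at h2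
      have h3 : ((orderOf s : ℕ) : k) ≠ 0 := by exact_mod_cast hs.orderOf_pos.ne'
      have h4 := Ideal.mul_mem_left _ (algebraMap k B (orderOf s : k)⁻¹) h2
      rwa [← mul_assoc, ← map_natCast (algebraMap k B), ← map_mul, inv_mul_cancel₀ h3, map_one,
        one_mul] at h4
  ext b
  have h1 : s b - b ∈ ⨅ i, m ^ i := by simpa using fun i => key i b
  rw [Ideal.iInf_pow_eq_bot_of_isDomain m hm] at h1
  exact sub_eq_zero.mp h1

/-- A finite group acting faithfully on a smooth affine variety with a fixed point has a faithful
representation on the cotangent space of that point. -/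
lemma Algebra.Smooth.exists_monoidHom_GL_injective {k B : Type u} [Field k] [CharZero k]
    [CommRing B] [IsDomain B] [Algebra k B] [Algebra.Smooth k B] (K : Type u) [Field K] [Algebra B K]
    [IsFractionRing B K] [Algebra k K] [IsScalarTower k B K] {G : Type v} [Group G] [Finite G]
    (ε : B →ₐ[k] k) (σ : G →* (B ≃ₐ[k] B)) (hσ : Function.Injective σ)
    (hε : ∀ g b, ε (σ g b) = ε b) {n : ℕ} (h : Algebra.trdeg k K ≤ n) :
    ∃ d ≤ n, ∃ r : G →* GL (Fin d) k, Function.Injective r := by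
  obtain ⟨h1, h2⟩ := finrank_cotangent_le K ε h
  have : IsNoetherianRing B := Algebra.FiniteType.isNoetherianRing k B
  refine ⟨_, h2, ?_⟩
  let m := RingHom.ker ε
  have hm (g) : m ≤ m.comap (σ g : B →ₐ[k] B) := fun b hb => (hε g b).trans hb
  let f : G →* Module.End k m.Cotangent :=
    { toFun g := m.mapCotangent m (σ g : B →ₐ[k] B) (hm g)
      map_one' := by
        ext x
        obtain ⟨x, rfl⟩ := m.toCotangent_surjective x
        rw [Ideal.mapCotangent_toCotangent]
        simp
      map_mul' g h := by
        ext x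
        obtain ⟨x, rfl⟩ := m.toCotangent_surjective x
        rw [Module.End.mul_apply]
        simp only [Ideal.mapCotangent_toCotangent]
        simp }
  let e := LinearMap.toMatrixAlgEquiv (Module.finBasis k m.Cotangent)
  let f' := (MulEquivClass.toMulEquiv e).toMonoidHom.comp f
  refine ⟨f'.toHomUnits, ?_⟩
  rw [injective_iff_map_eq_one]
  intro g hg
  have hg' : f g = 1 := e.injective ((congrArg Units.val hg).trans (map_one e).symm)
  refine hσ ((AlgEquiv.eq_one_of_sub_mem_sq ε (σ g)
    (MonoidHom.isOfFinOrder σ (isOfFinOrder_of_finite g)) (hε g)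
    fun b hb => ?_).trans (map_one σ).symm)
  have h3 := DFunLike.congr_fun hg' (m.toCotangent ⟨b, hb⟩)
  change m.mapCotangent m (σ g : B →ₐ[k] B) (hm g) _ = _ at h3
  rw [Ideal.mapCotangent_toCotangent, Module.End.one_apply, Ideal.toCotangent_eq] at h3
  exact h3

end

/-! ### Regular actions on stable affine opens -/

namespace Variety

variable {k : Type u} [Field k] {Y : Variety k}

attribute [local instance] sectionsAlgebra

/-- The action of an endomorphism on the sections over a stable open subset. -/
def sectionsMap (f : Y.scheme ⟶ Y.scheme) (hf : f ≫ Y.str = Y.str) (W : Y.scheme.Opens)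
    (h : W ≤ f ⁻¹ᵁ W) : Γ(Y.scheme, W) →ₐ[k] Γ(Y.scheme, W) where
  __ := (f.appLE W W h).hom
  commutes' x := by
    refine congrArg (fun f => f.hom x) (?_ : Y.sectionsBaseHom W ≫ f.appLE W W h =
      Y.sectionsBaseHom W)
    have h1 := f.appLE_comp_appLE Y.str ⊤ W W le_top h
    simp only [hf] at h1
    rw [sectionsBaseHom, Category.assoc, h1]

lemma sectionsMap_id (W : Y.scheme.Opens) :
    sectionsMap (𝟙 Y.scheme) (Category.id_comp _) W le_rfl = 1 := by
  refine AlgHom.ext fun x => congrArg (fun f => f.hom x)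
    (?_ : Scheme.Hom.appLE (𝟙 Y.scheme) W W le_rfl = 𝟙 _)
  exact (Scheme.Hom.appLE_eq_app _).trans (Scheme.Hom.id_app _)

lemma sectionsMap_comp (f g : Y.scheme ⟶ Y.scheme) (hf : f ≫ Y.str = Y.str)
    (hg : g ≫ Y.str = Y.str) (hfg : (f ≫ g) ≫ Y.str = Y.str) (W : Y.scheme.Opens)
    (hf' : W ≤ f ⁻¹ᵁ W) (hg' : W ≤ g ⁻¹ᵁ W) (hfg' : W ≤ (f ≫ g) ⁻¹ᵁ W) :
    sectionsMap (f ≫ g) hfg W hfg' = sectionsMap f hf W hf' * sectionsMap g hg W hg' :=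
  AlgHom.ext fun x => congrArg (fun f => f.hom x) (f.appLE_comp_appLE g W W W hg' hf').symm

/-- A nonempty open is dense and `Y` is separated, so agreeing with the identity on `W` suffices. -/
lemma eq_id_of_sectionsMap_eq_one {f : Y.scheme ⟶ Y.scheme} (hf : f ≫ Y.str = Y.str)
    {W : Y.scheme.Opens} (hW : IsAffineOpen W) [Nonempty W] (h : W ≤ f ⁻¹ᵁ W)
    (h1 : sectionsMap f hf W h = 1) : f = 𝟙 _ := by
  have h2 : f.appLE W W h = 𝟙 _ :=
    CommRingCat.hom_ext (RingHom.ext fun x => DFunLike.congr_fun h1 x)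
  have h3 : hW.fromSpec ≫ f = hW.fromSpec ≫ 𝟙 Y.scheme := by
    rw [← IsAffineOpen.SpecMap_appLE_fromSpec f hW hW h, h2, Spec.map_id, Category.id_comp,
      Category.comp_id]
  have hd : IsDominant hW.fromSpec := by
    refine ⟨?_⟩
    rw [DenseRange, hW.range_fromSpec]
    exact W.2.dense (Set.nonempty_coe_sort.mp ‹_›)
  exact ext_of_isDominant_of_isSeparated Y.str (hf.trans (Category.id_comp _).symm) hW.fromSpec h3

variable {G : Type v} [Group G]

/-- The morphism of schemes underlying the action of a group element. -/
def actHom (a : G →* Y.RegAut) (g : G) : Y.scheme ⟶ Y.scheme := (a g).hom.left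

lemma actHom_str (a : G →* Y.RegAut) (g : G) : actHom a g ≫ Y.str = Y.str := Over.w (a g).hom

lemma actHom_one (a : G →* Y.RegAut) : actHom a 1 = 𝟙 _ := by
  rw [actHom, map_one]
  rfl

lemma actHom_mul (a : G →* Y.RegAut) (g h : G) : actHom a (g * h) = actHom a h ≫ actHom a g := by
  rw [actHom, map_mul]
  rfl

lemma actHom_injective {a : G →* Y.RegAut} (ha : Function.Injective a) :
    Function.Injective (actHom a) := fun _ _ h =>
  ha (Iso.ext (Over.OverMorphism.ext h))

instance (a : G →* Y.RegAut) (g : G) : IsIso (actHom a g) :=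
  ⟨actHom a g⁻¹, by rw [← actHom_mul, inv_mul_cancel, actHom_one],
    by rw [← actHom_mul, mul_inv_cancel, actHom_one]⟩

/-- The action on the sections over a stable open subset induced by a regular action. -/
def sectionsAction (a : G →* Y.RegAut) (W : Y.scheme.Opens) (h : ∀ g, W ≤ actHom a g ⁻¹ᵁ W) :
    G →* (Γ(Y.scheme, W) ≃ₐ[k] Γ(Y.scheme, W)) :=
  (AlgEquiv.algHomUnitsEquiv k Γ(Y.scheme, W)).toMonoidHom.comp <| MonoidHom.toHomUnits
    { toFun g := sectionsMap (actHom a g⁻¹) (actHom_str a _) W (h g⁻¹)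
      map_one' := by
        rw [← sectionsMap_id W]
        congr 1
        rw [inv_one, actHom_one]
      map_mul' g g' := by
        rw [← sectionsMap_comp _ _ _ _ (by rw [← actHom_mul, actHom_str]) W _ _
          (by rw [← actHom_mul]; exact h _)]
        congr 1
        rw [mul_inv_rev, actHom_mul] }

lemma sectionsAction_injective {a : G →* Y.RegAut} (ha : Function.Injective a)
    {W : Y.scheme.Opens} (hW : IsAffineOpen W) [Nonempty W] (h : ∀ g, W ≤ actHom a g ⁻¹ᵁ W) :
    Function.Injective (sectionsAction a W h) := by
  rw [injective_iff_map_eq_one]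
  intro g hg
  have h1 : actHom a g⁻¹ = 𝟙 _ := eq_id_of_sectionsMap_eq_one (actHom_str a _) hW (h g⁻¹)
    (AlgHom.ext fun x => DFunLike.congr_fun hg x)
  exact inv_eq_one.mp (actHom_injective ha (h1.trans (actHom_one a).symm))

/-- A point fixed by a finite group has a stable affine neighbourhood. -/
lemma exists_stable_isAffineOpen [Finite G] (a : G →* Y.RegAut) (p : Y.scheme)
    (hp : ∀ g, actHom a g p = p) :
    ∃ W : Y.scheme.Opens, IsAffineOpen W ∧ p ∈ W ∧ ∀ g, W ≤ actHom a g ⁻¹ᵁ W := by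
  obtain ⟨U, hU, hpU⟩ := exists_isAffineOpen_mem p
  have hsep : Y.scheme.IsSeparated := by
    rw [Scheme.isSeparated_iff, ← Limits.terminal.comp_from Y.str]
    infer_instance
  have hmem (q : Y.scheme) : q ∈ ⨅ g, actHom a g ⁻¹ᵁ U ↔ ∀ g, actHom a g q ∈ U := by
    rw [← SetLike.mem_coe, TopologicalSpace.Opens.coe_iInf]
    simp
  -- A finite intersection of affine opens is affine because `Y` is separated.
  refine ⟨⨅ g, actHom a g ⁻¹ᵁ U, IsAffineOpen.iInf fun g => hU.preimage_of_isIso _, ?_, ?_⟩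
  · rw [hmem]
    exact fun g => (hp g).symm ▸ hpU
  · intro g q hq
    refine (hmem (actHom a g q)).mpr fun g' => ?_
    have := (hmem q).mp hq (g' * g)
    rwa [actHom_mul, Scheme.Hom.comp_apply] at this

/-- Evaluation of sections at a rational point. -/
def evalAt (y : Spec (.of k) ⟶ Y.scheme) (hy : y ≫ Y.str = 𝟙 _) (W : Y.scheme.Opens)
    (h : ⊤ ≤ y ⁻¹ᵁ W) : Γ(Y.scheme, W) →ₐ[k] k where
  __ := (y.appLE W ⊤ h ≫ (Scheme.ΓSpecIso (.of k)).hom).hom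
  commutes' x := by
    refine congrArg (fun f => f.hom x) (?_ : Y.sectionsBaseHom W ≫ y.appLE W ⊤ h ≫
      (Scheme.ΓSpecIso (.of k)).hom = 𝟙 _)
    have h1 : (y ≫ Y.str).appLE ⊤ ⊤ le_top = 𝟙 _ := by
      simp only [hy]
      exact (Scheme.Hom.appLE_eq_app _).trans (Scheme.Hom.id_app _)
    have h2 := y.appLE_comp_appLE Y.str ⊤ W ⊤ le_top h
    rw [sectionsBaseHom, Category.assoc, reassoc_of% h2, reassoc_of% h1, Iso.inv_hom_id]

lemma evalAt_sectionsMap (y : Spec (.of k) ⟶ Y.scheme) (hy : y ≫ Y.str = 𝟙 _)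
    (W : Y.scheme.Opens) (h : ⊤ ≤ y ⁻¹ᵁ W) (f : Y.scheme ⟶ Y.scheme) (hf : f ≫ Y.str = Y.str)
    (hf' : W ≤ f ⁻¹ᵁ W) (hyf : y ≫ f = y) (x : Γ(Y.scheme, W)) :
    evalAt y hy W h (sectionsMap f hf W hf' x) = evalAt y hy W h x := by
  refine congrArg (fun f => f.hom x) (?_ : f.appLE W W hf' ≫ y.appLE W ⊤ h ≫
    (Scheme.ΓSpecIso (.of k)).hom = y.appLE W ⊤ h ≫ (Scheme.ΓSpecIso (.of k)).hom)
  rw [← Category.assoc, Scheme.Hom.appLE_comp_appLE]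
  simp only [hyf]

lemma smooth_sections (hY : Smooth Y.str) {U : Y.scheme.Opens} (hU : IsAffineOpen U) :
    Algebra.Smooth k Γ(Y.scheme, U) := by
  have h := Y.str.smooth_appLE (isAffineOpen_top _) hU le_top
  have h1 : (Y.sectionsBaseHom U).hom.Smooth :=
    RingHom.Smooth.comp (.of_bijective
      (Scheme.ΓSpecIso (.of k)).symm.commRingCatIsoToRingEquiv.bijective) h
  exact h1

end Variety

lemma rdim_le {k : Type u} [Field k] {G : Type v} [Group G] {m : ℕ} (hm : 0 < m)
    (r : G →* GL (Fin m) k) (hr : Function.Injective r) : rdim k G ≤ m :=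
  Nat.sInf_le ⟨hm, r, hr⟩

/-! ### The dimension bound at a fixed point -/

namespace RationalAction

open Variety

variable {G : Type v} [Group G] {k : Type u} [Field k] {X : Variety k}

attribute [local instance] sectionsAlgebra

theorem rdim_le_of_hasFixedPoint [CharZero k] [Finite G] (ρ : RationalAction G X) {n : ℕ}
    (hn : 1 ≤ n) (hX : X.dim ≤ n) (h : ρ.HasFixedPoint) : rdim k G ≤ n := by
  obtain ⟨Y, a, ha, ψ, y, hY, -, -, hfix⟩ := h
  let p : Spec (.of k) ⟶ Y.scheme := y.left
  have hp : p ≫ Y.str = 𝟙 _ := Over.w y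
  have hpa (g) : p ≫ actHom a g = p := congrArg CommaMorphism.left (hfix g)
  let o : Spec (.of k) := IsLocalRing.closedPoint k
  obtain ⟨W, hW, hpW, hst⟩ := exists_stable_isAffineOpen a (p o) fun g => by
    rw [← Scheme.Hom.comp_apply, hpa]
  have : Nonempty W := ⟨⟨_, hpW⟩⟩
  have hpW' : ⊤ ≤ p ⁻¹ᵁ W := by
    intro q _
    have : q = o := Subsingleton.elim (α := PrimeSpectrum k) _ _
    exact this ▸ hpW
  have := smooth_sections hY hW
  have := isScalarTower_sections hW
  have := functionField_isFractionRing_of_isAffineOpen Y.scheme W hW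
  have htr : Algebra.trdeg k Y.scheme.functionField ≤ n :=
    (trdeg_le_of_injective (pullAlg ψ.hom) (pullAlg ψ.hom).toRingHom.injective).trans
      (trdeg_functionField_le hX)
  obtain ⟨d, hd, r, hr⟩ := Algebra.Smooth.exists_monoidHom_GL_injective Y.scheme.functionField
    (evalAt p hp W hpW') (sectionsAction a W hst) (sectionsAction_injective ha hW hst)
    (fun g x => evalAt_sectionsMap p hp W hpW' _ (actHom_str a _) (hst g⁻¹) (hpa g⁻¹) x) htr
  -- `rdim` only counts positive dimensions; a faithful representation in dimension 0 makes `G`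
  -- trivial, with `rdim` at most 1.
  rcases Nat.eq_zero_or_pos d with rfl | hd0
  · have : Subsingleton G := hr.subsingleton
    exact (rdim_le one_pos 1 (Function.injective_of_subsingleton _)).trans hn
  · exact (rdim_le hd0 r hr).trans hd

end RationalAction

end

theorem mainTheorem4 {k : Type*} [Field k] [IsAlgClosed k] [CharZero k]
    {G : Type*} [Group G] [Finite G] (n : ℕ) (hn : 1 ≤ n)
    (X : Variety k) (hX : X.dim = n) (ρ : RationalAction G X) :
    (ρ.HasFixedPoint → rdim k G ≤ n) ∧
    (rdim k G < n → ρ.CompressesToSmallerDim) ∧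
    (∀ (r : G →* GL (Fin n) k) (hr : Function.Injective r),
      ρ.CompressesToSmallerDim ∨
        ρ.IsNontrivialBaseChangeOf (RationalAction.linear r hr)) := by
  refine ⟨ρ.rdim_le_of_hasFixedPoint hn hX.le, ρ.compressesToSmallerDim_of_rdim_lt hX,
    ρ.compressesToSmallerDim_or_isNontrivialBaseChangeOf_linear hn hX⟩
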